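/- Let $(S,\mathfrak m)$ and $M$ be of one of the following two kinds. (a) $S$ is a regular local ring (hence Noetherian) and a domain, $\mathfrak m$ is its maximal ideal, and $M$ is a finitely generated $S$-module. (b) $S=\bigoplus_{i\ge 0}S_i$ is a commutative, finitely generated graded algebra over a field $k$ with $S_0=k$ which is a regular ring (all localizations at primes are regular local rings) and a domain, $\mathfrak m=\bigoplus_{i>0}S_i$, and $M=\bigoplus_{j\in\mathbb Z}M_j$ is a finitely generated graded $S$-module. Suppose that the projective dimension of $M$ over $S$ is the integer $e\ge 0$ (in particular $M\neq 0$), and put $I=\operatorname{ann}_S\operatorname{Ext}^e_S(M,S)$. Write $\operatorname{depth}M$ for the supremum of the lengths of $M$-regular sequences contained in $\mathfrak m$, and $\omega M=\min\{\dim S/P \mid P\in\operatorname{Ass}_S M\}$. Let $H^0_I(M)$ denote the zeroth local cohomology module of $M$ with respect to $I$. Then the following are equivalent: 1. $\operatorname{depth} M=\omega M$; 2. $H^0_I(M)\neq 0$; 3. $\operatorname{Hom}_S(\operatorname{Ext}^e_S(M,S),M)\neq 0$; 4. $\operatorname{Tor}^S_e(M,M)\neq 0$. -/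

import Mathlib

open CategoryTheory

universe u v

/-- The depth of `M` with respect to the ideal `J`: the supremum of the lengths of the
`M`-regular sequences whose terms all lie in `J`. -/
noncomputable def depthAt {S : Type u} [CommRing S] (J : Ideal S)
    (M : Type u) [AddCommGroup M] [Module S M] : ℕ∞ :=
  ⨆ (rs : List S) (_ : RingTheory.Sequence.IsRegular M rs ∧ ∀ r ∈ rs, r ∈ J), (rs.length : ℕ∞)

/-- `ω M = min {dim S/P | P ∈ Ass M}`.  For a nonzero module over a Noetherian ring the set is
nonempty, and its infimum in the well-ordered set `WithBot ℕ∞` is a minimum. -/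
noncomputable def omegaInv (S : Type u) [CommRing S]
    (M : Type u) [AddCommGroup M] [Module S M] : WithBot ℕ∞ :=
  sInf {d | ∃ P ∈ associatedPrimes S M, d = ringKrullDim (S ⧸ P)}

/-- The `S`-module `Ext^e_S(M, S)`. -/
abbrev ExtSelf (S : Type u) [CommRing S] (M : Type u) [AddCommGroup M] [Module S M] (e : ℕ) :
    Type u :=
  Abelian.Ext (ModuleCat.of S M) (ModuleCat.of S S) e

/-- The module `H^i_J(M)`. -/
noncomputable abbrev localCoh {S : Type u} [CommRing S] (J : Ideal S) (i : ℕ)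
    (M : Type u) [AddCommGroup M] [Module S M] : ModuleCat.{u} S :=
  (localCohomology J i).obj (ModuleCat.of S M)

/-- The module `Tor_i^S(M, N)`. -/
noncomputable abbrev TorMod (S : Type u) [CommRing S] (i : ℕ)
    (M N : Type u) [AddCommGroup M] [Module S M] [AddCommGroup N] [Module S N] : ModuleCat.{u} S :=
  ((Tor (ModuleCat.{u} S) i).obj (ModuleCat.of S M)).obj (ModuleCat.of S N)

/-! Everything is read off from the associated primes P of M. The residue field of S_P embeds in
M_P, and over a regular local ring such a finite module has the largest possible projective
dimension. Hence pd M_P = ht P, and so ht P ≤ e. On the other hand, Ext^e(M, S) is the top Ext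
module, and it is supported exactly at the primes where the projective dimension of M does not drop
below e. So an associated prime P contains I if and only if ht P = e
(`height_le_and_annihilator_extSelf_le_iff`).

Conditions 2 and 3 each say that some associated prime of M contains I
(`nontrivial_localCoh_zero_iff`, `nontrivial_linearMap_iff`). For condition 1, put d = ht 𝔪.
Auslander–Buchsbaum gives depth M = d - e (`depthAt_eq`), while dim S/P = d - ht P. Since ht P ≤ e
always, depth M ≤ ω M, with equality exactly when some associated prime has height e. Condition 4
agrees with condition 3 because N ⊗ K = Hom(K*, N) for finite projective K, which identifies the
last Tor with Hom out of the last Ext; only the equivalence of nonvanishing is needed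
(`nontrivial_torMod_iff`).

The inputs about regular rings are that the residue field of S_P has projective dimension ht P and
that ht P + dim S/P = d. Both come from comparing maximal regular sequences inside P with associated
primes of the quotient.

The graded case reduces to S_𝔪. An element outside 𝔪 has a unit as its degree-zero component, and
this one fact gives that associated primes lie in 𝔪, that pd M_𝔪 = e, and that homogeneous
generators of 𝔪 can be found locally, whence dim S ≤ ht 𝔪. -/

/-! ### Localization of projective dimension, and the support of the top Ext module. -/

section ExtAndLocalization

variable {S : Type u} [CommRing S]

/-- The localization map of a module, with source the module itself. -/
noncomputable def localizedMk (T : Submonoid S) (M : Type u) [AddCommGroup M] [Module S M] :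
    M →ₗ[S] (ModuleCat.of S M).localizedModule T :=
  (ModuleCat.of S M).localizedModuleMkLinearMap T

instance (T : Submonoid S) (M : Type u) [AddCommGroup M] [Module S M] :
    IsLocalizedModule T (localizedMk T M) :=
  ModuleCat.localizedModule_isLocalizedModule (ModuleCat.of S M) T

/-- A section exists after localizing. Finite presentation turns it into a map `M → F` at the cost
of one denominator; a second one makes the splitting identity hold in `M` itself. -/
theorem exists_smul_section_of_projective_localizedModule [IsNoetherianRing S] (T : Submonoid S)
    {F M : Type u} [AddCommGroup F] [Module S F] [AddCommGroup M] [Module S M] [Module.Finite S M]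
    (g : F →ₗ[S] M) (hg : Function.Surjective g)
    (hp : Module.Projective (Localization T) ((ModuleCat.of S M).localizedModule T)) :
    ∃ s ∈ T, ∃ σ : M →ₗ[S] F, g ∘ₗ σ = s • LinearMap.id := by
  let mF := localizedMk T F
  let mM := localizedMk T M
  let gT := IsLocalizedModule.mapExtendScalars T mF mM (Localization T) g
  have hgT : Function.Surjective gT := IsLocalizedModule.map_surjective T mF mM g hg
  obtain ⟨τ, hτ⟩ := Module.projective_lifting_property gT LinearMap.id hgT
  have : Module.FinitePresentation S M := Module.finitePresentation_of_finite S M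
  obtain ⟨h', s, hs⟩ := Module.FinitePresentation.exists_lift_of_isLocalizedModule T mF
    ((τ.restrictScalars S) ∘ₗ mM)
  have hcomp (x : F) : gT (mF x) = mM (g x) := IsLocalizedModule.map_apply T mF mM g x
  have key : mM ∘ₗ (g ∘ₗ h') = mM ∘ₗ ((s : S) • LinearMap.id) := by
    ext x
    have h1 : mF (h' x) = (s : S) • τ (mM x) := LinearMap.congr_fun hs x
    have h2 : gT (τ (mM x)) = mM x := LinearMap.congr_fun hτ (mM x)
    have h3 : gT ((s : S) • τ (mM x)) = (s : S) • gT (τ (mM x)) :=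
      (gT.restrictScalars S).map_smul _ _
    simp only [LinearMap.comp_apply, LinearMap.smul_apply, LinearMap.id_apply, map_smul]
    rw [← hcomp, h1, h3, h2]
  obtain ⟨s', hs'⟩ := Module.Finite.exists_smul_of_comp_eq_of_isLocalizedModule T mM _ _ key
  refine ⟨s' * s, (s' * s).2, (s' : S) • h', ?_⟩
  rw [LinearMap.comp_smul, mul_smul]
  exact hs'

/-- `s` annihilates `Ext^n(M, L)` for every finite module `L`. -/
def KillsExt (M : Type u) [AddCommGroup M] [Module S M] (n : ℕ) (s : S) : Prop :=
  ∀ (L : Type u) [AddCommGroup L] [Module S L] [Module.Finite S L]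
    (x : Abelian.Ext (ModuleCat.of S M) (ModuleCat.of S L) n), s • x = 0

open Abelian

theorem ext_smul_eq_comp {M L : ModuleCat.{u} S} {n : ℕ} (x : Ext M L n) (s : S) :
    s • x = (Ext.mk₀ (s • 𝟙 M)).comp x (zero_add n) := by
  simp [Ext.mk₀_smul]

theorem killsExt_one_of_section {F M : Type u} [AddCommGroup F] [Module S F] [AddCommGroup M]
    [Module S M] [Module.Projective S F] (g : F →ₗ[S] M) (s : S) (σ : M →ₗ[S] F)
    (h : g ∘ₗ σ = s • LinearMap.id) : KillsExt M 1 s := by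
  intro L _ _ _ x
  have h1 : s • 𝟙 (ModuleCat.of S M) = ModuleCat.ofHom σ ≫ ModuleCat.ofHom g := by
    ext y
    exact (LinearMap.congr_fun h y).symm
  have : Projective (ModuleCat.of S F) := ModuleCat.projective_of_categoryTheory_projective _
  rw [ext_smul_eq_comp, h1, ← Ext.mk₀_comp_mk₀, Ext.comp_assoc_of_second_deg_zero,
    ((Ext.mk₀ (ModuleCat.ofHom g)).comp x (zero_add 1)).eq_zero_of_projective, Ext.comp_zero]

theorem exists_section_of_killsExt_one [IsNoetherianRing S] {F M : Type u} [AddCommGroup F]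
    [Module S F] [Module.Finite S F] [AddCommGroup M]
    [Module S M] (g : F →ₗ[S] M) (hg : Function.Surjective g) (s : S) (h : KillsExt M 1 s) :
    ∃ σ : M →ₗ[S] F, g ∘ₗ σ = s • LinearMap.id := by
  have hS := LinearMap.shortExact_shortComplexKer hg
  have h0 : (Ext.mk₀ (s • 𝟙 (ModuleCat.of S M))).comp hS.extClass (zero_add 1) = 0 := by
    rw [← ext_smul_eq_comp]
    exact h (LinearMap.ker g) hS.extClass
  obtain ⟨y, hy⟩ := Ext.covariant_sequence_exact₃ (ModuleCat.of S M) hS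
    (Ext.mk₀ (s • 𝟙 (ModuleCat.of S M))) (zero_add 1) h0
  obtain ⟨f, rfl⟩ := (Ext.mk₀_bijective _ _).2 y
  rw [Ext.mk₀_comp_mk₀, (Ext.mk₀_bijective _ _).1.eq_iff] at hy
  refine ⟨f.hom, ?_⟩
  ext x
  exact congr_arg (fun q => q.hom x) hy

/-- Dimension shifting as an isomorphism. -/
noncomputable def extShift {F M : Type u} [AddCommGroup F] [Module S F] [AddCommGroup M]
    [Module S M] [Module.Projective S F] (g : F →ₗ[S] M) (hg : Function.Surjective g)
    (L : ModuleCat.{u} S) (n : ℕ) :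
    Ext (ModuleCat.of S (LinearMap.ker g)) L (n + 1) ≃ₗ[S] Ext (ModuleCat.of S M) L (n + 2) :=
  LinearEquiv.ofBijective
    ((LinearMap.shortExact_shortComplexKer hg).extClass.precompOfLinear S L (add_comm 1 (n + 1))) <| by
    have hS := LinearMap.shortExact_shortComplexKer hg
    have : Projective (ModuleCat.of S F) := ModuleCat.projective_of_categoryTheory_projective _
    refine ⟨(injective_iff_map_eq_zero _).2 fun x hx => ?_, fun x => ?_⟩
    · obtain ⟨y, rfl⟩ := Ext.contravariant_sequence_exact₁ hS L x (add_comm 1 (n + 1)) hx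
      rw [Ext.eq_zero_of_projective y, Ext.comp_zero]
    · exact Ext.contravariant_sequence_exact₃ hS L x (Ext.eq_zero_of_projective _)
        (add_comm 1 (n + 1))

theorem killsExt_add_two_iff {F M : Type u} [AddCommGroup F] [Module S F] [AddCommGroup M]
    [Module S M] [Module.Projective S F] (g : F →ₗ[S] M) (hg : Function.Surjective g)
    (n : ℕ) (s : S) : KillsExt M (n + 2) s ↔ KillsExt (LinearMap.ker g) (n + 1) s := by
  constructor
  · intro h L _ _ _ x
    apply (extShift g hg (ModuleCat.of S L) n).injective
    rw [map_smul, h, map_zero]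
  · intro h L _ _ _ x
    obtain ⟨y, rfl⟩ := (extShift g hg (ModuleCat.of S L) n).surjective x
    rw [← map_smul, h, map_zero]

theorem killsExt_zero_iff {M : Type u} [AddCommGroup M] [Module S M] [Module.Finite S M] (s : S) :
    KillsExt M 0 s ↔ ∀ m : M, s • m = 0 := by
  constructor
  · intro h m
    have := h M (Ext.mk₀ (𝟙 (ModuleCat.of S M)))
    rw [← Ext.mk₀_smul, ← Ext.mk₀_zero, (Ext.mk₀_bijective _ _).1.eq_iff] at this
    exact congr_arg (fun q => q.hom m) this
  · intro h L _ _ _ x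
    have : s • 𝟙 (ModuleCat.of S M) = 0 := by
      ext m
      exact h m
    rw [ext_smul_eq_comp, this, Ext.mk₀_zero, Ext.zero_comp]

theorem hasProjectiveDimensionLT_zero_localizedModule_iff (T : Submonoid S) (M : Type u)
    [AddCommGroup M] [Module S M] [Module.Finite S M] :
    HasProjectiveDimensionLT ((ModuleCat.of S M).localizedModule T) 0 ↔
      ∃ s ∈ T, ∀ m : M, s • m = 0 := by
  rw [hasProjectiveDimensionLT_zero_iff_isZero, ModuleCat.isZero_iff_subsingleton]
  rw [IsLocalizedModule.subsingleton_iff_ker_eq_top T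
    (localizedMk T M)]
  constructor
  · intro h
    have : localizedMk T M ∘ₗ LinearMap.id =
        localizedMk T M ∘ₗ (0 : M →ₗ[S] M) := by
      ext x
      have : x ∈ LinearMap.ker (localizedMk T M) := h ▸ trivial
      simpa using this
    obtain ⟨s, hs⟩ := Module.Finite.exists_smul_of_comp_eq_of_isLocalizedModule T _ _ _ this
    exact ⟨s, s.2, fun m => (LinearMap.congr_fun hs m).trans (smul_zero _)⟩
  · rintro ⟨s, hs, h⟩
    rw [eq_top_iff]
    intro x _
    exact (IsLocalizedModule.eq_zero_iff T _).2 ⟨⟨s, hs⟩, h x⟩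

/-- An elementwise substitute for localizing Ext. Degrees 0 and 1 are separate base cases because
the shift along `ker g` is an isomorphism only from positive degrees. -/
theorem hasProjectiveDimensionLT_localizedModule_iff [IsNoetherianRing S] (T : Submonoid S)
    (n : ℕ) (M : Type u) [AddCommGroup M] [Module S M] [Module.Finite S M] :
    HasProjectiveDimensionLT ((ModuleCat.of S M).localizedModule T) n ↔
      ∃ s ∈ T, KillsExt M n s := by
  induction n using Nat.twoStepInduction generalizing M with
  | zero =>
    simp_rw [hasProjectiveDimensionLT_zero_localizedModule_iff, killsExt_zero_iff]
  | one =>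
    obtain ⟨F, _, _, _, _, g, hg⟩ := Module.exists_finite_presentation S M
    rw [← projective_iff_hasProjectiveDimensionLT_one, ← IsProjective.iff_projective]
    constructor
    · intro hp
      obtain ⟨s, hs, σ, h⟩ := exists_smul_section_of_projective_localizedModule T g hg hp
      exact ⟨s, hs, killsExt_one_of_section g s σ h⟩
    · rintro ⟨s, hs, h⟩
      obtain ⟨σ, hσ⟩ := exists_section_of_killsExt_one g hg s h
      let mF := localizedMk T F
      let mM := localizedMk T M
      let gT := IsLocalizedModule.mapExtendScalars T mF mM (Localization T) g
      let σT := IsLocalizedModule.mapExtendScalars T mM mF (Localization T) σ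
      have : Module.Projective (Localization T) ((ModuleCat.of S F).localizedModule T) :=
        Module.projective_of_isLocalizedModule T mF
      -- `σ` splits `g` only up to the factor `s`, which becomes invertible in the localization.
      refine Module.Projective.of_split ((IsLocalization.mk' (Localization T) 1 ⟨s, hs⟩) • σT) gT ?_
      apply LinearMap.restrictScalars_injective S
      apply IsLocalizedModule.ext T mM (IsLocalizedModule.map_units mM)
      ext x
      have h1 : σT (mM x) = mF (σ x) := IsLocalizedModule.map_apply T mM mF σ x
      have h2 : gT (mF (σ x)) = mM (g (σ x)) := IsLocalizedModule.map_apply T mF mM g _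
      have h3 : g (σ x) = s • x := LinearMap.congr_fun hσ x
      have h4 : (s : S) • mM x = algebraMap S (Localization T) s • mM x := by
        rw [algebraMap_smul]
      simp only [LinearMap.comp_apply, LinearMap.restrictScalars_apply, LinearMap.smul_apply,
        map_smul, h1, h2, h3, h4, smul_smul, LinearMap.id_apply]
      have h5 : IsLocalization.mk' (Localization T) 1 ⟨s, hs⟩ * algebraMap S (Localization T) s =
          algebraMap S (Localization T) 1 := IsLocalization.mk'_spec (Localization T) 1 ⟨s, hs⟩
      rw [h5, map_one, one_smul]
  | more n _ ih =>
    obtain ⟨F, _, _, _, _, g, hg⟩ := Module.exists_finite_presentation S M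
    have hS := (LinearMap.shortExact_shortComplexKer hg).map_of_exact
      (ModuleCat.localizedModuleFunctor T)
    have : Projective (ModuleCat.of S F) := ModuleCat.projective_of_categoryTheory_projective _
    have := (ModuleCat.localizedModuleFunctor.{u} T).projective_obj (ModuleCat.of S F)
    refine (hS.hasProjectiveDimensionLT_X₃_iff n this).trans ((ih (LinearMap.ker g)).trans ?_)
    simp_rw [killsExt_add_two_iff g hg]

/-- As Ext^(e+1)(M, -) vanishes, Ext^e(M, -) is right exact; a finite `L` is a quotient of some S^n,
so killing Ext^e(M, S) is enough. -/
theorem killsExt_of_smul_ext_self [IsNoetherianRing S] (M : Type u) [AddCommGroup M] [Module S M]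
    (e : ℕ) [HasProjectiveDimensionLE (ModuleCat.of S M) e] (s : S)
    (h : ∀ x : ExtSelf S M e, s • x = 0) : KillsExt M e s := by
  intro L _ _ _ x
  obtain ⟨n, g, hg⟩ := Module.Finite.exists_fin' S L
  have hS := LinearMap.shortExact_shortComplexKer hg
  obtain ⟨y, rfl⟩ := Ext.covariant_sequence_exact₃ (ModuleCat.of S M) hS x rfl
    (Ext.eq_zero_of_hasProjectiveDimensionLT _ (e + 1) le_rfl)
  suffices s • y = 0 by
    rw [← Ext.smul_comp, this, Ext.zero_comp]
  have hid : 𝟙 (ModuleCat.of S (Fin n → S)) =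
      ∑ i, ModuleCat.ofHom (LinearMap.proj i) ≫
        ModuleCat.ofHom (LinearMap.single S (fun _ : Fin n => S) i) := by
    ext x j
    simp [ModuleCat.hom_sum, Pi.single_apply]
  have hy : y = ∑ i, (y.comp (Ext.mk₀ (ModuleCat.ofHom (LinearMap.proj i))) (add_zero e)).comp
      (Ext.mk₀ (ModuleCat.ofHom (LinearMap.single S (fun _ : Fin n => S) i))) (add_zero e) := by
    conv_lhs => rw [← y.comp_mk₀_id, hid]
    rw [Ext.mk₀_sum, Ext.comp_sum]
    refine Finset.sum_congr rfl fun i _ => ?_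
    rw [← Ext.mk₀_comp_mk₀, Ext.comp_assoc_of_third_deg_zero]
  rw [hy, Finset.smul_sum]
  refine Finset.sum_eq_zero fun i _ => ?_
  rw [← Ext.smul_comp, h, Ext.zero_comp]

theorem annihilator_extSelf_le_iff [IsNoetherianRing S] (M : Type u) [AddCommGroup M] [Module S M]
    [Module.Finite S M] (e : ℕ) [HasProjectiveDimensionLE (ModuleCat.of S M) e]
    (P : Ideal S) [P.IsPrime] :
    Module.annihilator S (ExtSelf S M e) ≤ P ↔
      ¬ HasProjectiveDimensionLT ((ModuleCat.of S M).localizedModule P.primeCompl) e := by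
  rw [hasProjectiveDimensionLT_localizedModule_iff, not_exists]
  constructor
  · rintro h s ⟨hs, hk⟩
    exact hs (h (Module.mem_annihilator.2 fun x => hk S x))
  · intro h s hs
    by_contra hsP
    exact h s ⟨hsP, killsExt_of_smul_ext_self M e s (Module.mem_annihilator.1 hs)⟩

end ExtAndLocalization

/-! ### Regular sequences, associated primes and projective dimension over local rings. -/

section LocalAlgebra

open IsLocalRing RingTheory.Sequence Abelian Pointwise

theorem shortExact_ofHom {R : Type u} [CommRing R] {N₁ N₂ N₃ : Type u} [AddCommGroup N₁]
    [Module R N₁] [AddCommGroup N₂] [Module R N₂] [AddCommGroup N₃] [Module R N₃]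
    (f : N₁ →ₗ[R] N₂) (g : N₂ →ₗ[R] N₃) (hf : Function.Injective f) (hg : Function.Surjective g)
    (hfg : Function.Exact f g) :
    (ModuleCat.shortComplexOfCompEqZero f g hfg.linearMap_comp_eq_zero).ShortExact where
  exact := (ShortComplex.ShortExact.moduleCat_exact_iff_function_exact _).mpr hfg
  mono_f := (ModuleCat.mono_iff_injective _).mpr hf
  epi_g := (ModuleCat.epi_iff_surjective _).mpr hg

variable {R : Type u} [CommRing R] [IsNoetherianRing R]

/-- Take a sequence of maximal length. If `J` were in no associated prime of the quotient, prime
avoidance would give an element of `J` prolonging the sequence. -/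
theorem exists_isWeaklyRegular_le_associatedPrime (J : Ideal R) (M : Type u) [AddCommGroup M]
    [Module R M] [Module.Finite R M] (B : ℕ)
    (hB : ∀ rs : List R, IsWeaklyRegular M rs → (∀ r ∈ rs, r ∈ J) → rs.length ≤ B) :
    ∃ rs : List R, IsWeaklyRegular M rs ∧ (∀ r ∈ rs, r ∈ J) ∧
      ∃ Q ∈ associatedPrimes R (M ⧸ (Ideal.ofList rs • ⊤ : Submodule R M)), J ≤ Q := by
  obtain ⟨n, ⟨rs, hrs, hJ, rfl⟩, hmax⟩ : ∃ n, (∃ rs : List R, IsWeaklyRegular M rs ∧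
      (∀ r ∈ rs, r ∈ J) ∧ rs.length = n) ∧ ∀ rs : List R, IsWeaklyRegular M rs →
      (∀ r ∈ rs, r ∈ J) → rs.length ≤ n := by
    classical
    let p : ℕ → Prop := fun n => ∃ rs : List R, IsWeaklyRegular M rs ∧
      (∀ r ∈ rs, r ∈ J) ∧ rs.length = n
    have h0 : p 0 := ⟨[], IsWeaklyRegular.nil R M, by simp, rfl⟩
    exact ⟨Nat.findGreatest p B, Nat.findGreatest_spec (Nat.zero_le B) h0, fun rs h1 h2 =>
      Nat.le_findGreatest (hB rs h1 h2) ⟨rs, h1, h2, rfl⟩⟩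
  refine ⟨rs, hrs, hJ, ?_⟩
  by_contra! hQ
  have hsub : ¬ ((J : Set R) ⊆ ⋃ Q ∈ associatedPrimes R (M ⧸ (Ideal.ofList rs • ⊤ : Submodule R M)),
      (Q : Set R)) := by
    intro h
    obtain ⟨Q, h1, h2⟩ := (Ideal.subset_union_prime_finite
      (associatedPrimes.finite R (M ⧸ (Ideal.ofList rs • ⊤ : Submodule R M)))
      (f := id) 0 0 fun _ h _ _ ↦ h.isPrime).1 h
    exact hQ Q h1 h2
  rw [biUnion_associatedPrimes_eq_compl_regular R, Set.subset_compl_iff_disjoint_right,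
    Set.not_disjoint_iff] at hsub
  obtain ⟨x, hx, hreg⟩ := hsub
  have h1 : IsWeaklyRegular M (rs ++ [x]) :=
    (isWeaklyRegular_append_iff M rs [x]).2 ⟨hrs, (isWeaklyRegular_singleton_iff _ x).2 hreg⟩
  have := hmax (rs ++ [x]) h1 (by
    intro r hr
    rcases List.mem_append.1 hr with h | h
    · exact hJ r h
    · rw [List.mem_singleton.1 h]; exact hx)
  simp at this

/-- After localizing at `Q` the sequence lowers the dimension by exactly its length, and what
remains is nonnegative. -/
theorem length_le_height_of_isWeaklyRegular (rs : List R) (hrs : IsWeaklyRegular R rs)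
    (Q : Ideal R) [Q.IsPrime] (h : ∀ r ∈ rs, r ∈ Q) : (rs.length : ℕ∞) ≤ Q.height := by
  have h1 := hrs.isRegular_of_isLocalization_of_mem (Localization.AtPrime Q) Q h
  have h2 := ringKrullDim_add_length_eq_ringKrullDim_of_isRegular _ h1
  rw [IsLocalization.AtPrime.ringKrullDim_eq_height Q (Localization.AtPrime Q), List.length_map] at h2
  have h3 : (0 : WithBot ℕ∞) ≤ ringKrullDim (Localization.AtPrime Q ⧸
      Ideal.ofList (rs.map (algebraMap R (Localization.AtPrime Q)))) := by
    have : Nontrivial (Localization.AtPrime Q ⧸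
        Ideal.ofList (rs.map (algebraMap R (Localization.AtPrime Q)))) := by
      apply Ideal.Quotient.nontrivial_iff.2
      have := h1.top_ne_smul
      rw [smul_eq_mul, Ideal.mul_top] at this
      exact this.symm
    exact ringKrullDim_nonneg_of_nontrivial
  rw [← WithBot.coe_le_coe, ← h2]
  exact le_add_of_nonneg_left h3

variable [IsLocalRing R]

/-- In the long exact sequence of multiplication by `x`, the vanishing makes `x` surjective on
Ext^i(N, L), and Nakayama finishes. -/
theorem subsingleton_ext_of_quotSMulTop {N L : Type u} [AddCommGroup N] [Module R N]
    [Module.Finite R N] [AddCommGroup L] [Module R L] [Module.Finite R L] {x : R}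
    (reg : IsSMulRegular N x) (mem : x ∈ maximalIdeal R) (i : ℕ)
    (h : Subsingleton (Ext (ModuleCat.of R (QuotSMulTop x N)) (ModuleCat.of R L) (i + 1))) :
    Subsingleton (Ext (ModuleCat.of R N) (ModuleCat.of R L) i) := by
  have hS : ((ModuleCat.of R N).smulShortComplex x).ShortExact := reg.smulShortComplex_shortExact
  by_contra! ntr
  have : x ∈ (Module.annihilator R (Ext (ModuleCat.of R N) (ModuleCat.of R L) i)).jacobson :=
    (IsLocalRing.maximalIdeal_le_jacobson _) mem
  absurd Submodule.top_ne_pointwise_smul_of_mem_jacobson_annihilator this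
  rw [eq_comm, eq_top_iff]
  intro y _
  obtain ⟨z, hz⟩ := Ext.contravariant_sequence_exact₁ hS (ModuleCat.of R L) y (add_comm 1 i)
    (@Subsingleton.elim _ h _ _)
  change Ext (ModuleCat.of R N) (ModuleCat.of R L) i at z
  have hz' : x • z = y := (ext_smul_eq_comp (M := ModuleCat.of R N) z x).trans hz
  rw [← hz']
  exact Submodule.smul_mem_pointwise_smul z x ⊤ trivial

/-- Noetherian induction from the maximal ideal downwards: for `x` outside `p`, the module R/(p, x)
involves only primes strictly above `p`, and its bound passes back to R/p by Nakayama. -/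
theorem hasProjectiveDimensionLE_quotient_prime (n : ℕ)
    [HasProjectiveDimensionLE (ModuleCat.of R (R ⧸ maximalIdeal R)) n]
    (p : Ideal R) (hp : p.IsPrime) : HasProjectiveDimensionLE (ModuleCat.of R (R ⧸ p)) n := by
  induction p using WellFoundedGT.induction with
  | ind p ih =>
  rcases eq_or_ne p (maximalIdeal R) with rfl | hne
  · assumption
  obtain ⟨x, hxm, hxp⟩ : ∃ x ∈ maximalIdeal R, x ∉ p := by
    by_contra! h
    exact hne (le_antisymm (le_maximalIdeal hp.ne_top) h)
  have reg : IsSMulRegular (R ⧸ p) x := by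
    rw [isSMulRegular_iff_right_eq_zero_of_smul]
    intro a ha
    obtain ⟨a, rfl⟩ := Ideal.Quotient.mk_surjective a
    rw [← Ideal.Quotient.mk_eq_mk, ← Submodule.Quotient.mk_smul, Submodule.Quotient.mk_eq_zero,
      smul_eq_mul] at ha
    exact Ideal.Quotient.eq_zero_iff_mem.2 ((hp.mem_or_mem ha).resolve_left hxp)
  -- A prime filtration extends the induction hypothesis to modules: every prime occurring contains
  -- the annihilator, hence lies strictly above `p`.
  have key (N : Type u) [AddCommGroup N] [Module R N] [hN : Module.Finite R N] :
      p < Module.annihilator R N → HasProjectiveDimensionLE (ModuleCat.of R N) n := by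
    induction hN using IsNoetherianRing.induction_on_isQuotientEquivQuotientPrime R with
    | subsingleton N =>
      intro _
      have : Limits.IsZero (ModuleCat.of R N) := ModuleCat.isZero_of_subsingleton _
      have := this.hasProjectiveDimensionLT_zero
      exact hasProjectiveDimensionLT_of_ge _ 0 _ (Nat.zero_le _)
    | quotient N q e =>
      intro hlt
      have hq : Module.annihilator R N = q.1 := by
        rw [e.annihilator_eq, Ideal.annihilator_quotient]
      rw [hq] at hlt
      have := ih q.1 hlt q.2
      exact hasProjectiveDimensionLT_of_iso e.symm.toModuleIso (n + 1)
    | exact N₁ N₂ N₃ f g hf hg hfg ih₁ ih₃ =>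
      intro hlt
      have hS := shortExact_ofHom f g hf hg hfg
      exact hS.hasProjectiveDimensionLT_X₂ (n + 1)
        (ih₁ (hlt.trans_le (f.annihilator_le_of_injective hf)))
        (ih₃ (hlt.trans_le (g.annihilator_le_of_surjective hg)))
  have hB : HasProjectiveDimensionLE (ModuleCat.of R (QuotSMulTop x (R ⧸ p))) n := by
    apply key
    refine lt_of_le_of_ne ?_ ?_
    · intro a ha
      rw [Module.mem_annihilator]
      intro m
      obtain ⟨m, rfl⟩ := Submodule.mkQ_surjective _ m
      obtain ⟨m, rfl⟩ := Ideal.Quotient.mk_surjective m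
      rw [← map_smul]
      have : a • (Ideal.Quotient.mk p m) = 0 := by
        rw [← Ideal.Quotient.mk_eq_mk, ← Submodule.Quotient.mk_smul, Submodule.Quotient.mk_eq_zero]
        exact p.mul_mem_right m ha
      rw [this, map_zero]
    · intro h
      apply hxp
      rw [h]
      exact QuotSMulTop.mem_annihilator _ x
  apply ModuleCat.hasProjectiveDimensionLT_of_forall_finite
  intro L _
  exact subsingleton_ext_of_quotSMulTop (L := L) reg hxm (n + 1)
    (HasProjectiveDimensionLT.subsingleton _ (n + 1) _ (Nat.le_succ _) L)

theorem hasProjectiveDimensionLE_of_residueField (n : ℕ)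
    [HasProjectiveDimensionLE (ModuleCat.of R (R ⧸ maximalIdeal R)) n]
    (N : Type u) [AddCommGroup N] [Module R N] [hN : Module.Finite R N] :
    HasProjectiveDimensionLE (ModuleCat.of R N) n := by
  induction hN using IsNoetherianRing.induction_on_isQuotientEquivQuotientPrime R with
  | subsingleton N =>
    have : Limits.IsZero (ModuleCat.of R N) := ModuleCat.isZero_of_subsingleton _
    have := this.hasProjectiveDimensionLT_zero
    exact hasProjectiveDimensionLT_of_ge _ 0 _ (Nat.zero_le _)
  | quotient N q e =>
    have := hasProjectiveDimensionLE_quotient_prime n q.1 q.2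
    exact hasProjectiveDimensionLT_of_iso e.symm.toModuleIso (n + 1)
  | exact N₁ N₂ N₃ f g hf hg hfg ih₁ ih₃ =>
    exact (shortExact_ofHom f g hf hg hfg).hasProjectiveDimensionLT_X₂ (n + 1) ih₁ ih₃

/-- The residue field embeds in `N` with a cokernel of projective dimension at most `n`. Were pd N <
n, the short exact sequence would force the residue field below `n` too. -/
theorem projectiveDimension_eq_of_maximalIdeal_mem_associatedPrimes {n : ℕ}
    (hn : projectiveDimension (ModuleCat.of R (R ⧸ maximalIdeal R)) = n)
    (N : Type u) [AddCommGroup N] [Module R N] [Module.Finite R N]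
    (hN : maximalIdeal R ∈ associatedPrimes R N) :
    projectiveDimension (ModuleCat.of R N) = n := by
  have hk : HasProjectiveDimensionLE (ModuleCat.of R (R ⧸ maximalIdeal R)) n :=
    (projectiveDimension_le_iff _ n).1 hn.le
  refine le_antisymm ((projectiveDimension_le_iff _ n).2
    (hasProjectiveDimensionLE_of_residueField n N)) ?_
  rw [projectiveDimension_ge_iff]
  intro hlt
  refine absurd hn.ge ?_
  rw [projectiveDimension_ge_iff, not_not]
  obtain ⟨_, f, hf⟩ := (isAssociatedPrime_iff_exists_injective_linearMap _ _).1 hN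
  have hS := shortExact_ofHom f (LinearMap.range f).mkQ hf (Submodule.mkQ_surjective _)
    (f.exact_map_mkQ_range)
  exact hS.hasProjectiveDimensionLT_X₁ n hlt
    (hasProjectiveDimensionLE_of_residueField n (N ⧸ LinearMap.range f))

/-- Depth is at most dim R/Q for each associated `Q`. Modulo the first element `x`, some associated
prime contains `Q` and also `x`, which is not in `Q`; so dim R/Q drops by at least one at each step.
-/
theorem length_le_ringKrullDim_quotient_of_isRegular (rs : List R) (N : Type u) [AddCommGroup N]
    [Module R N] [Module.Finite R N] (hrs : IsRegular N rs) (Q : Ideal R)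
    (hQ : Q ∈ associatedPrimes R N) : (rs.length : WithBot ℕ∞) ≤ ringKrullDim (R ⧸ Q) := by
  induction rs generalizing N Q with
  | nil =>
    have := hQ.isPrime
    simpa using ringKrullDim_nonneg_of_nontrivial
  | cons x rs ih =>
    have hxm : x ∈ maximalIdeal R := by
      simpa using fun isu ↦ hrs.2 (by simp [Ideal.span_singleton_eq_top.mpr isu])
    obtain ⟨hx, hrs'⟩ := (isRegular_cons_iff N x rs).1 hrs
    obtain ⟨hQp, n₀, hn₀⟩ := isAssociatedPrime_iff.1 hQ
    let N' : Submodule R N := Submodule.torsionBySet R N Q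
    have hn₀' : n₀ ∈ N' := (Submodule.mem_torsionBySet_iff _ _).2 fun a => by
      have : (a : R) ∈ Submodule.colon ⊥ {n₀} := hn₀ ▸ a.2
      simpa [Submodule.mem_colon_singleton] using this
    have hn₀0 : n₀ ≠ 0 := by
      rintro rfl
      exact hQp.ne_top (by rw [hn₀]; simp)
    -- If the part `N'` killed by `Q` lay in xN, regularity of `x` would give N' = xN', hence N' = 0
    -- by Nakayama. So some element killed by `Q` survives modulo `x`.
    obtain ⟨n₁, hn₁, hn₁x⟩ : ∃ n₁ ∈ N', n₁ ∉ (x • ⊤ : Submodule R N) := by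
      by_contra! h
      have : N' ≤ maximalIdeal R • N' := by
        intro a ha
        obtain ⟨b, -, rfl⟩ := (Submodule.mem_smul_pointwise_iff_exists _ _ _).1 (h a ha)
        refine Submodule.smul_mem_smul hxm ((Submodule.mem_torsionBySet_iff _ _).2 fun q => ?_)
        have h1 := (Submodule.mem_torsionBySet_iff _ _).1 ha q
        rw [smul_comm] at h1
        exact (isSMulRegular_iff_right_eq_zero_of_smul.1 hx) _ h1
      have := Submodule.eq_bot_of_le_smul_of_le_jacobson_bot (maximalIdeal R) N'
        (IsNoetherian.noetherian N') this (maximalIdeal_le_jacobson _)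
      rw [this, Submodule.mem_bot] at hn₀'
      exact hn₀0 hn₀'
    have hmk : (Submodule.Quotient.mk n₁ : QuotSMulTop x N) ≠ 0 := by
      rwa [ne_eq, Submodule.Quotient.mk_eq_zero]
    obtain ⟨Q', hQ', hle⟩ := exists_le_isAssociatedPrime_of_isNoetherianRing R
      (Submodule.Quotient.mk n₁ : QuotSMulTop x N) hmk
    have := hQ'.isPrime
    have hQQ' : Q ≤ Q' := by
      refine le_trans (fun a ha => ?_) hle
      have := (Submodule.mem_torsionBySet_iff _ _).1 hn₁ ⟨a, ha⟩
      simp only [Submodule.mem_colon_singleton, Submodule.mem_bot]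
      rw [← Submodule.Quotient.mk_smul]
      exact congrArg _ this
    have hxQ' : x ∈ Q' := by
      apply hle
      simp only [Submodule.mem_colon_singleton, Submodule.mem_bot]
      exact Module.mem_annihilator.1 (QuotSMulTop.mem_annihilator N x) _
    have hxQ : x ∉ Q := by
      intro h
      rw [hn₀, Submodule.mem_colon_singleton, Submodule.mem_bot] at h
      exact hn₀0 (isSMulRegular_iff_right_eq_zero_of_smul.1 hx _ h)
    have h1 := ih (QuotSMulTop x N) hrs' Q' hQ'
    have h2 : ringKrullDim (R ⧸ Q') + 1 ≤ ringKrullDim (R ⧸ Q) := by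
      refine ringKrullDim_succ_le_of_surjective (Ideal.Quotient.factor hQQ')
        (Ideal.Quotient.factor_surjective hQQ') (r := Ideal.Quotient.mk Q x) ?_ ?_
      · rw [mem_nonZeroDivisors_iff_ne_zero, ne_eq, Ideal.Quotient.eq_zero_iff_mem]
        exact hxQ
      · simpa [Ideal.Quotient.eq_zero_iff_mem] using hxQ'
    refine le_trans ?_ h2
    rw [List.length_cons, Nat.cast_succ]
    gcongr

end LocalAlgebra

/-! ### Regular local rings: domain property, regular parameters, the residue field. -/

section RegularLocal

open IsLocalRing RingTheory.Sequence Pointwise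

/-- The exchange lemma: since `x` is outside the square of the maximal ideal, some coefficient in
its expansion is a unit, and that generator can be traded for `x`. -/
theorem exists_span_insert_erase_eq_maximalIdeal {R : Type u} [CommRing R] [IsLocalRing R]
    (Y : Finset R) (hY : Ideal.span (Y : Set R) = maximalIdeal R) {x : R}
    (hx : x ∈ maximalIdeal R) (hx2 : x ∉ maximalIdeal R ^ 2) :
    ∃ Z : Finset R, Z.card + 1 = Y.card ∧
      Ideal.span (insert x (Z : Set R)) = maximalIdeal R := by
  classical
  rw [← hY, Submodule.mem_span_finset'] at hx
  obtain ⟨a, ha⟩ := hx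
  have hmem : ∀ y : Y, (y : R) ∈ maximalIdeal R := fun y => hY ▸ Ideal.subset_span y.2
  obtain ⟨y, hy⟩ : ∃ y, IsUnit (a y) := by
    by_contra! h
    apply hx2
    rw [← ha, pow_two]
    exact Submodule.sum_mem _ fun y _ =>
      Ideal.mul_mem_mul ((mem_maximalIdeal _).2 (h y)) (hmem y)
  refine ⟨Y.erase y, Finset.card_erase_add_one y.2, le_antisymm ?_ ?_⟩
  · rw [Ideal.span_le]
    rintro z (rfl | hz)
    · rw [SetLike.mem_coe, ← ha]
      exact Submodule.sum_mem _ fun y _ => Ideal.mul_mem_left _ _ (hmem y)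
    · exact hmem ⟨z, Finset.mem_of_mem_erase hz⟩
  · have key : ∀ z ∈ Y, z ≠ y → z ∈ Ideal.span (insert x ((Y.erase y : Finset R) : Set R)) := by
      intro z hz hne
      exact Ideal.subset_span (Set.mem_insert_of_mem _ (Finset.mem_erase.2 ⟨hne, hz⟩))
    rw [← hY, Ideal.span_le]
    intro z hz
    by_cases hzy : z = y
    · subst hzy
      rw [← Finset.add_sum_erase _ _ (Finset.mem_univ y)] at ha
      have : a y • (y : R) ∈ Ideal.span (insert x ((Y.erase y : Finset R) : Set R)) := by
        rw [eq_sub_of_add_eq ha]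
        refine sub_mem (Ideal.subset_span (Set.mem_insert _ _)) (Submodule.sum_mem _ ?_)
        intro z hz
        exact Ideal.mul_mem_left _ _ (key z z.2 fun h => (Finset.mem_erase.1 hz).1 (Subtype.ext h))
      exact (Ideal.unit_mul_mem_iff_mem _ hy).1 this
    · exact key z hz hzy

theorem isRegularLocalRing_of_span {R : Type u} [CommRing R] [IsLocalRing R] [IsNoetherianRing R]
    (Z : Finset R) (hZ : Ideal.span (Z : Set R) = maximalIdeal R)
    (h : (Z.card : WithBot ℕ∞) ≤ ringKrullDim R) : IsRegularLocalRing R := by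
  refine .of_spanFinrank_maximalIdeal_le _ (le_trans ?_ h)
  rw [← hZ]
  exact_mod_cast (Submodule.spanFinrank_span_le_ncard_of_finite Z.finite_toSet).trans
    (Set.ncard_coe_finset Z).le

theorem maximalIdeal_quotient_eq_map {R : Type u} [CommRing R] [IsLocalRing R] (I : Ideal R)
    [IsLocalRing (R ⧸ I)] : maximalIdeal (R ⧸ I) = (maximalIdeal R).map (Ideal.Quotient.mk I) := by
  have h1 : Ideal.comap (Ideal.Quotient.mk I) (maximalIdeal (R ⧸ I)) = maximalIdeal R :=
    eq_maximalIdeal (Ideal.comap_isMaximal_of_surjective _ Ideal.Quotient.mk_surjective)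
  rw [← h1, Ideal.map_comap_of_surjective _ Ideal.Quotient.mk_surjective]

/-- Killing `A` lowers the dimension by at most its cardinality, while the images of `Z` generate
the maximal ideal of the quotient; the two bounds meet. -/
theorem isRegularLocalRing_quotient_span {R : Type u} [CommRing R] [IsLocalRing R]
    [IsNoetherianRing R] [DecidableEq R] (A Z : Finset R)
    (hAZ : Ideal.span ((A ∪ Z : Finset R) : Set R) = maximalIdeal R)
    (h : ((A.card + Z.card : ℕ) : WithBot ℕ∞) ≤ ringKrullDim R) :
    IsRegularLocalRing (R ⧸ Ideal.span (A : Set R)) ∧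
      ringKrullDim (R ⧸ Ideal.span (A : Set R)) = Z.card := by
  have hA : (A : Set R) ⊆ maximalIdeal R := by
    intro a ha
    rw [← hAZ]
    exact Ideal.subset_span (by simp [Finset.mem_coe.1 ha])
  have : Nontrivial (R ⧸ Ideal.span (A : Set R)) := Ideal.Quotient.nontrivial_iff.2
    (ne_top_of_le_ne_top (maximalIdeal.isMaximal R).ne_top (Ideal.span_le.2 hA))
  have := IsLocalRing.of_surjective' (Ideal.Quotient.mk (Ideal.span (A : Set R)))
    Ideal.Quotient.mk_surjective
  classical
  have hspan : Ideal.span ((Z.image (Ideal.Quotient.mk (Ideal.span (A : Set R))) : Finset _) :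
      Set (R ⧸ Ideal.span (A : Set R))) = maximalIdeal _ := by
    rw [maximalIdeal_quotient_eq_map, ← hAZ, Finset.coe_union, Ideal.span_union, Ideal.map_sup,
      Ideal.map_quotient_self, bot_sup_eq, Ideal.map_span, Finset.coe_image]
  have hcard : ((Z.image (Ideal.Quotient.mk (Ideal.span (A : Set R)))).card : WithBot ℕ∞) ≤
      Z.card := by exact_mod_cast Finset.card_image_le
  have hdim : (Z.card : WithBot ℕ∞) ≤ ringKrullDim (R ⧸ Ideal.span (A : Set R)) := by
    have h2 := h.trans (ringKrullDim_le_ringKrullDim_quotient_add_card A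
      (hA.trans (by rw [IsLocalRing.ringJacobson_eq_maximalIdeal])))
    push_cast at h2
    rw [add_comm] at h2
    obtain ⟨c, hc⟩ : ∃ c : ℕ∞, ringKrullDim (R ⧸ Ideal.span (A : Set R)) = c :=
      ⟨_, (WithBot.coe_unbot _ ringKrullDim_ne_bot).symm⟩
    rw [hc] at h2 ⊢
    norm_cast at h2 ⊢
    exact (WithTop.add_le_add_iff_right (WithTop.natCast_ne_top _)).1 h2
  have hreg := isRegularLocalRing_of_span _ hspan (hcard.trans hdim)
  refine ⟨hreg, le_antisymm ?_ hdim⟩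
  rw [← hreg.spanFinrank_maximalIdeal, ← hspan]
  refine le_trans ?_ hcard
  exact_mod_cast (Submodule.spanFinrank_span_le_ncard_of_finite (Finset.finite_toSet _)).trans
    (Set.ncard_coe_finset _).le

theorem IsRegularLocalRing.exists_finset_span (R : Type u) [CommRing R] [IsRegularLocalRing R] :
    ∃ Y : Finset R, Ideal.span (Y : Set R) = maximalIdeal R ∧
      (Y.card : WithBot ℕ∞) = ringKrullDim R := by
  have fg : (maximalIdeal R).FG := (maximalIdeal R).fg_of_isNoetherianRing
  refine ⟨(Submodule.FG.finite_generators fg).toFinset, ?_, ?_⟩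
  · rw [Set.Finite.coe_toFinset]
    exact Submodule.span_generators _
  · rw [← IsRegularLocalRing.spanFinrank_maximalIdeal, ← Set.ncard_eq_toFinset_card _
      (Submodule.FG.finite_generators fg), Submodule.FG.generators_ncard fg]

/-- Induction on the dimension. Choose `x` in 𝔪, outside 𝔪² and all minimal primes; then (x) is
prime by induction. A minimal prime q ⊆ (x) satisfies q = xq because x ∉ q, so q = 0 by Nakayama. -/
theorem IsRegularLocalRing.isDomain (R : Type u) [CommRing R] [IsRegularLocalRing R] :
    IsDomain R := by
  obtain ⟨Y, hY, hd⟩ := IsRegularLocalRing.exists_finset_span R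
  generalize hn : Y.card = n at hd
  induction n generalizing R with
  | zero =>
    rw [Finset.card_eq_zero.1 hn, Finset.coe_empty, Ideal.span_empty] at hY
    exact (isField_iff_maximalIdeal_eq.2 hY.symm).isDomain
  | succ n ih =>
    classical
    obtain ⟨x, hx, hx2, hxmin⟩ : ∃ x ∈ maximalIdeal R, x ∉ maximalIdeal R ^ 2 ∧
        ∀ q ∈ minimalPrimes R, x ∉ q := by
      by_contra! hcon
      let T : Set (Ideal R) := insert (maximalIdeal R ^ 2) (minimalPrimes R)
      have hsub : ((maximalIdeal R : Ideal R) : Set R) ⊆ ⋃ q ∈ T, (q : Set R) := by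
        intro x hx
        by_cases h : x ∈ maximalIdeal R ^ 2
        · exact Set.mem_biUnion (Set.mem_insert _ _) h
        · obtain ⟨q, hq, hxq⟩ := hcon x hx h
          exact Set.mem_biUnion (Set.mem_insert_of_mem _ hq) hxq
      obtain ⟨q, hqT, hle⟩ := (Ideal.subset_union_prime_finite
        ((minimalPrimes.finite_of_isNoetherianRing R).insert _) (f := id)
        (maximalIdeal R ^ 2) (maximalIdeal R ^ 2) (fun q hq h _ =>
          (Ideal.IsMinimalPrime.isPrime (hq.resolve_left h)))).1 hsub
      rcases hqT with rfl | hq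
      · have hbot : maximalIdeal R = ⊥ := by
          refine Submodule.eq_bot_of_le_smul_of_le_jacobson_bot (maximalIdeal R) _
            (IsNoetherian.noetherian _) ?_ (maximalIdeal_le_jacobson _)
          rw [smul_eq_mul, ← pow_two]
          exact hle
        have : ringKrullDim R = 0 := ringKrullDim_eq_zero_of_isField
          (isField_iff_maximalIdeal_eq.2 hbot)
        rw [this] at hd
        norm_cast at hd
      · have := Ideal.IsMinimalPrime.isPrime hq
        have hq' : q = maximalIdeal R := le_antisymm (le_maximalIdeal this.ne_top) hle
        have h0 : (maximalIdeal R).height = 0 := by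
          rw [← hq']; exact Ideal.height_eq_zero_iff.2 hq
        rw [← maximalIdeal_height_eq_ringKrullDim, h0] at hd
        norm_cast at hd
    obtain ⟨Z, hZ, hspan⟩ := exists_span_insert_erase_eq_maximalIdeal Y hY hx hx2
    have hZ' : Z.card = n := by omega
    obtain ⟨hreg, hdim⟩ := isRegularLocalRing_quotient_span {x} Z (by simpa using hspan)
      (by rw [← hd, Finset.card_singleton, hZ', add_comm])
    obtain ⟨Y', hY', hd'⟩ := IsRegularLocalRing.exists_finset_span
      (R ⧸ Ideal.span (({x} : Finset R) : Set R))
    have hcard : Y'.card = n := by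
      rw [← hd', hZ'] at hdim
      exact_mod_cast hdim
    have hdom := ih _ Y' hY' hcard (by rw [← hd', hcard])
    rw [Finset.coe_singleton, Ideal.Quotient.isDomain_iff_prime] at hdom
    obtain ⟨q, hq, hle⟩ := Ideal.exists_minimalPrimes_le (I := ⊥) (J := Ideal.span {x}) bot_le
    have hqp := Ideal.IsMinimalPrime.isPrime hq
    have hq0 : q = ⊥ := by
      refine Submodule.eq_bot_of_le_smul_of_le_jacobson_bot (maximalIdeal R) _
        (IsNoetherian.noetherian _) ?_ (maximalIdeal_le_jacobson _)
      intro a ha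
      obtain ⟨b, rfl⟩ := Ideal.mem_span_singleton'.1 (hle ha)
      rw [mul_comm]
      exact Submodule.smul_mem_smul hx ((hqp.mem_or_mem ha).resolve_right (hxmin q hq))
    rw [hq0] at hqp
    exact IsDomain.of_bot_isPrime R

theorem IsRegularLocalRing.exists_isRegular_ofList_eq (R : Type u) [CommRing R]
    [IsRegularLocalRing R] : ∃ rs : List R, IsRegular R rs ∧ Ideal.ofList rs = maximalIdeal R ∧
      (rs.length : WithBot ℕ∞) = ringKrullDim R := by
  classical
  obtain ⟨Y, hY, hd⟩ := IsRegularLocalRing.exists_finset_span R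
  have hspan : Ideal.ofList Y.toList = maximalIdeal R := by
    rw [← hY, Ideal.ofList]
    simp
  refine ⟨Y.toList, ⟨⟨fun i hi => ?_⟩, ?_⟩, hspan, by simpa using hd⟩
  · set rs := Y.toList with hrs
    let A : Finset R := (rs.take i).toFinset
    let Z : Finset R := (rs.drop i).toFinset
    have hnd : rs.Nodup := Y.nodup_toList
    have hA : A.card = i := by
      rw [List.toFinset_card_of_nodup (hnd.sublist (List.take_sublist _ _)), List.length_take]
      omega
    have hZ : Z.card = rs.length - i := by
      rw [List.toFinset_card_of_nodup (hnd.sublist (List.drop_sublist _ _)), List.length_drop]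
    have hlen : rs.length = Y.card := by simp [hrs]
    obtain ⟨hreg, hdim⟩ := isRegularLocalRing_quotient_span A Z (by
      rw [← List.toFinset_append, List.take_append_drop, ← hspan, Ideal.ofList]
      simp) (by rw [← hd, hA, hZ]; norm_cast; omega)
    have hdom := IsRegularLocalRing.isDomain (R ⧸ Ideal.span (A : Set R))
    rw [Ideal.Quotient.isDomain_iff_prime] at hdom
    have hA' : Ideal.span (A : Set R) = Ideal.ofList (rs.take i) := by
      rw [Ideal.ofList]; simp [A]
    -- Otherwise this generator would be redundant, and the maximal ideal would have fewer
    -- generators than the dimension.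
    have hnot : rs[i] ∉ Ideal.ofList (rs.take i) := by
      intro hmem
      have h1 : Ideal.span ((Y.erase rs[i] : Finset R) : Set R) = maximalIdeal R := by
        refine le_antisymm (hY ▸ Ideal.span_mono (by simp)) ?_
        rw [← hY, Ideal.span_le]
        intro z hz
        by_cases hzr : z = rs[i]
        · rw [hzr]
          refine Ideal.span_mono ?_ hmem
          intro w hw
          have hw1 := List.mem_take_iff_getElem.1 hw
          obtain ⟨j, hj, rfl⟩ := hw1
          rw [Finset.mem_coe, Finset.mem_erase]
          refine ⟨fun h => ?_, ?_⟩
          · have := (List.Nodup.getElem_inj_iff hnd).1 h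
            omega
          · exact Finset.mem_toList.1 (List.getElem_mem _)
        · exact Ideal.subset_span (Finset.mem_erase.2 ⟨hzr, hz⟩)
      have h2 := ringKrullDim_le_spanFinrank_maximalIdeal R
      rw [← hd, ← h1] at h2
      have h3 := (Submodule.spanFinrank_span_le_ncard_of_finite (R := R)
        (Finset.finite_toSet (Y.erase rs[i]))).trans (Set.ncard_coe_finset _).le
      have h4 : rs[i] ∈ Y := Finset.mem_toList.1 (List.getElem_mem _)
      rw [Finset.card_erase_of_mem h4] at h3
      have h5 : Y.card ≤ Submodule.spanFinrank (Ideal.span ((Y.erase rs[i] : Finset R) : Set R)) := by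
        exact_mod_cast h2
      have := Finset.card_pos.2 ⟨_, h4⟩
      simp only [Ideal.span] at h5
      omega
    rw [hA'] at hdom
    rw [isSMulRegular_iff_right_eq_zero_of_smul]
    intro a ha
    obtain ⟨a, rfl⟩ := Submodule.mkQ_surjective _ a
    rw [← map_smul, Submodule.mkQ_apply, Submodule.Quotient.mk_eq_zero, smul_eq_mul, smul_eq_mul,
      Ideal.mul_top] at ha
    rw [Submodule.mkQ_apply, Submodule.Quotient.mk_eq_zero, smul_eq_mul, Ideal.mul_top]
    exact (hdom.mem_or_mem ha).resolve_left hnot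
  · rw [hspan, smul_eq_mul, Ideal.mul_top]
    exact (maximalIdeal.isMaximal R).ne_top.symm

theorem IsRegularLocalRing.projectiveDimension_residueField {R : Type u} [CommRing R]
    [IsRegularLocalRing R] {n : ℕ} (hn : ringKrullDim R = n) :
    projectiveDimension (ModuleCat.of R (R ⧸ maximalIdeal R)) = n := by
  obtain ⟨rs, hrs, hspan, hlen⟩ := IsRegularLocalRing.exists_isRegular_ofList_eq R
  have hlen' : rs.length = n := by rw [hn] at hlen; exact_mod_cast hlen
  have h := ModuleCat.projectiveDimension_quotient_eq_length.{u} rs hrs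
  rw [← hspan, ← hlen', ← h]
  exact projectiveDimension_eq_of_iso (Shrink.linearEquiv R _).symm.toModuleIso

end RegularLocal

/-! ### The Auslander–Buchsbaum formula at a maximal ideal. -/

section Depth

open IsLocalRing RingTheory.Sequence Pointwise

variable {S : Type u} [CommRing S] [IsNoetherianRing S] (𝔪 : Ideal S) [h𝔪 : 𝔪.IsMaximal]
  (A : Type u) [CommRing A] [IsLocalRing A] [IsNoetherianRing A] [Algebra S A]
  [IsLocalization.AtPrime A 𝔪]

-- Each term of the sequence raises the projective dimension of the localized quotient by one, and
-- `d` bounds that dimension for all finite modules over `A`.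
omit [IsNoetherianRing S] in
theorem add_length_le_of_isWeaklyRegular {M M' : Type u} [AddCommGroup M] [Module S M]
    [AddCommGroup M'] [Module S M'] [Module A M'] [IsScalarTower S A M'] [Module.Finite A M']
    [Nontrivial M'] (f : M →ₗ[S] M') [IsLocalizedModule.AtPrime 𝔪 f] {d e : ℕ}
    (hd : projectiveDimension (ModuleCat.of A (A ⧸ maximalIdeal A)) = d)
    (he : projectiveDimension (ModuleCat.of A M') = e) {rs : List S}
    (hrs : IsWeaklyRegular M rs) (hmem : ∀ r ∈ rs, r ∈ 𝔪) : e + rs.length ≤ d := by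
  have h1 := hrs.isRegular_of_isLocalizedModule_of_mem A 𝔪 f hmem
  have h2 := ModuleCat.projectiveDimension_quotient_eq_add_length_of_isWeaklyRegular
    (ModuleCat.of A M') _ h1.1 (by
      intro r hr
      obtain ⟨s, hs, rfl⟩ := List.mem_map.1 hr
      exact (IsLocalization.AtPrime.to_map_mem_maximal_iff A 𝔪 s).2 (hmem s hs))
  have : HasProjectiveDimensionLE (ModuleCat.of A (A ⧸ maximalIdeal A)) d :=
    (projectiveDimension_le_iff _ d).1 hd.le
  have h3 := (projectiveDimension_le_iff _ d).2 (hasProjectiveDimensionLE_of_residueField (R := A) d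
    (M' ⧸ (Ideal.ofList (rs.map (algebraMap S A)) • ⊤ : Submodule A M')))
  rw [h2, he, List.length_map] at h3
  exact_mod_cast h3

/-- For a maximal sequence in 𝔪, the ideal 𝔪 is associated to the quotient, so after localization
the quotient has the extreme projective dimension `d`. -/
theorem exists_isRegular_add_length_eq {M M' : Type u} [AddCommGroup M] [Module S M]
    [Module.Finite S M] [AddCommGroup M'] [Module S M'] [Module A M'] [IsScalarTower S A M']
    [Module.Finite A M'] [Nontrivial M'] (f : M →ₗ[S] M') [IsLocalizedModule.AtPrime 𝔪 f] {d e : ℕ}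
    (hd : projectiveDimension (ModuleCat.of A (A ⧸ maximalIdeal A)) = d)
    (he : projectiveDimension (ModuleCat.of A M') = e) :
    ∃ rs : List S, IsRegular M rs ∧ (∀ r ∈ rs, r ∈ 𝔪) ∧ e + rs.length = d := by
  obtain ⟨rs, hrs, hmem, Q, hQ, hle⟩ := exists_isWeaklyRegular_le_associatedPrime 𝔪 M d
    (fun rs hrs hmem => (Nat.le_add_left _ _).trans
      (add_length_le_of_isWeaklyRegular 𝔪 A f hd he hrs hmem))
  obtain rfl : 𝔪 = Q := h𝔪.eq_of_le hQ.isPrime.ne_top hle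
  have h1 := hrs.isRegular_of_isLocalizedModule_of_mem A 𝔪 f hmem
  have h2 := ModuleCat.projectiveDimension_quotient_eq_add_length_of_isWeaklyRegular
    (ModuleCat.of A M') _ h1.1 (by
      intro r hr
      obtain ⟨s, hs, rfl⟩ := List.mem_map.1 hr
      exact (IsLocalization.AtPrime.to_map_mem_maximal_iff A 𝔪 s).2 (hmem s hs))
  have hloc : (Ideal.ofList rs • ⊤ : Submodule S M).localized' A 𝔪.primeCompl f =
      Ideal.ofList (rs.map (algebraMap S A)) • ⊤ := by
    rw [Submodule.localized'_smul, Ideal.localized'_eq_map, Submodule.localized'_top,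
      Ideal.map_ofList]
  -- `S` need not be local, so properness of rs • M is deduced from the localization.
  refine ⟨rs, ⟨hrs, fun h => ?_⟩, hmem, ?_⟩
  · apply h1.2
    rw [← hloc, ← h, Submodule.localized'_top]
  · have h3 : maximalIdeal A ∈ associatedPrimes A
        (M' ⧸ (Ideal.ofList rs • ⊤ : Submodule S M).localized' A 𝔪.primeCompl f) := by
      apply Module.associatedPrimes.mem_associatedPrimes_of_comap_mem_associatedPrimes_of_isLocalizedModule
        𝔪.primeCompl (Submodule.toLocalizedQuotient' A 𝔪.primeCompl f (Ideal.ofList rs • ⊤))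
      have : (maximalIdeal A).comap (algebraMap S A) = 𝔪 :=
        IsLocalization.AtPrime.under_maximalIdeal A 𝔪
      rwa [this]
    rw [hloc] at h3
    have h4 := projectiveDimension_eq_of_maximalIdeal_mem_associatedPrimes hd _ h3
    have h5 := h2.symm.trans h4
    rw [he, List.length_map] at h5
    exact_mod_cast h5

theorem depthAt_eq {M M' : Type u} [AddCommGroup M] [Module S M]
    [Module.Finite S M] [AddCommGroup M'] [Module S M'] [Module A M'] [IsScalarTower S A M']
    [Module.Finite A M'] [Nontrivial M'] (f : M →ₗ[S] M') [IsLocalizedModule.AtPrime 𝔪 f] {d e : ℕ}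
    (hd : projectiveDimension (ModuleCat.of A (A ⧸ maximalIdeal A)) = d)
    (he : projectiveDimension (ModuleCat.of A M') = e) :
    ∃ l : ℕ, depthAt 𝔪 M = l ∧ e + l = d := by
  obtain ⟨rs, hrs, hmem, hlen⟩ := exists_isRegular_add_length_eq 𝔪 A f hd he
  refine ⟨rs.length, le_antisymm ?_ ?_, hlen⟩
  · refine iSup₂_le fun rs' h => ?_
    have := add_length_le_of_isWeaklyRegular 𝔪 A f hd he h.1.1 h.2
    exact_mod_cast (by omega : rs'.length ≤ rs.length)
  · exact le_iSup₂_of_le rs ⟨hrs, hmem⟩ le_rfl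

end Depth

/-! ### Primes of a regular local ring: the dimension formula and localized residue fields. -/

section RegularLocalPrimes

open IsLocalRing RingTheory.Sequence Pointwise

instance isLocalization_atPrime_maximalIdeal_self (R : Type u) [CommRing R] [IsLocalRing R] :
    IsLocalization.AtPrime R (maximalIdeal R) :=
  IsLocalization.self fun x hx => (IsUnit.mem_submonoid_iff x).2 (by simpa using hx)

instance isLocalizedModule_maximalIdeal_id (R M : Type u) [CommRing R] [IsLocalRing R]
    [AddCommGroup M] [Module R M] :
    IsLocalizedModule.AtPrime (maximalIdeal R) (LinearMap.id : M →ₗ[R] M) :=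
  isLocalizedModule_id _ M R

theorem ringKrullDim_quotient_eq_coheight {R : Type u} [CommRing R] (x : PrimeSpectrum R) :
    ringKrullDim (R ⧸ x.asIdeal) = Order.coheight x := by
  rw [ringKrullDim_quotient, Order.coheight_eq_krullDim_Ici]
  rfl

theorem Ideal.height_add_ringKrullDim_quotient_le {R : Type u} [CommRing R] (P : Ideal R)
    [hP : P.IsPrime] : (P.height : WithBot ℕ∞) + ringKrullDim (R ⧸ P) ≤ ringKrullDim R := by
  let x : PrimeSpectrum R := ⟨P, hP⟩
  have : Nonempty (PrimeSpectrum R) := ⟨x⟩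
  have h1 : ringKrullDim (R ⧸ P) = Order.coheight x := ringKrullDim_quotient_eq_coheight x
  rw [h1, PrimeSpectrum.height_eq_orderHeight x, ringKrullDim,
    Order.krullDim_eq_iSup_height_add_coheight_of_nonempty, ← WithBot.coe_add, WithBot.coe_le_coe]
  exact le_iSup (fun a : PrimeSpectrum R => Order.height a + Order.coheight a) x

theorem exists_ringKrullDim_eq_natCast (R : Type u) [CommRing R] [IsLocalRing R]
    [IsNoetherianRing R] : ∃ d : ℕ, ringKrullDim R = d := by
  obtain ⟨c, hc⟩ : ∃ c : ℕ∞, ringKrullDim R = c :=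
    ⟨_, (WithBot.coe_unbot _ ringKrullDim_ne_bot).symm⟩
  have : c ≠ ⊤ := by
    rintro rfl
    exact ringKrullDim_ne_top hc
  lift c to ℕ using this
  exact ⟨c, hc⟩

theorem exists_isRegular_of_isLocalRing {R : Type u} [CommRing R] [IsNoetherianRing R]
    [IsLocalRing R] {M : Type u} [AddCommGroup M] [Module R M] [Module.Finite R M] [Nontrivial M]
    {d e : ℕ} (hd : projectiveDimension (ModuleCat.of R (R ⧸ maximalIdeal R)) = d)
    (he : projectiveDimension (ModuleCat.of R M) = e) :
    ∃ rs : List R, IsRegular M rs ∧ e + rs.length = d := by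
  obtain ⟨rs, h1, -, h2⟩ := exists_isRegular_add_length_eq (maximalIdeal R) R
    (LinearMap.id : M →ₗ[R] M) hd he
  exact ⟨rs, h1, h2⟩

theorem projectiveDimension_quotient_ofList {R : Type u} [CommRing R] [IsNoetherianRing R]
    [IsLocalRing R] {rs : List R} (hrs : IsWeaklyRegular R rs)
    (hmem : ∀ r ∈ rs, r ∈ maximalIdeal R) :
    projectiveDimension (ModuleCat.of R (R ⧸ (Ideal.ofList rs • ⊤ : Submodule R R))) =
      rs.length := by
  have h2 := ModuleCat.projectiveDimension_quotient_eq_add_length_of_isWeaklyRegular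
    (ModuleCat.of R R) rs hrs hmem
  have h0 : projectiveDimension (ModuleCat.of R R) = 0 :=
    ModuleCat.projectiveDimension_eq_zero_of_projective _
  rw [h0, zero_add] at h2
  exact h2

/-- Let r be the length of a maximal regular sequence in P, and Q ⊇ P an associated prime of the
quotient. The quotient has depth d - r, so d - r ≤ dim R/Q ≤ dim R/P ≤ d - ht P. With r ≤ ht P, all
of these are equalities. -/
theorem IsRegularLocalRing.exists_isWeaklyRegular_height {R : Type u} [CommRing R]
    [IsRegularLocalRing R] (P : Ideal R) [hP : P.IsPrime] : ∃ rs : List R,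
    IsWeaklyRegular R rs ∧ (∀ r ∈ rs, r ∈ P) ∧ (rs.length : ℕ∞) = P.height ∧
      (P.height : WithBot ℕ∞) + ringKrullDim (R ⧸ P) = ringKrullDim R := by
  obtain ⟨d, hd⟩ := exists_ringKrullDim_eq_natCast R
  have hpd := IsRegularLocalRing.projectiveDimension_residueField hd
  have hPd : P.height ≤ d := by
    have := Ideal.height_le_ringKrullDim_of_isPrime (I := P)
    rw [hd] at this
    exact_mod_cast this
  obtain ⟨rs, hrs, hmem, Q, hQ, hle⟩ := exists_isWeaklyRegular_le_associatedPrime P R d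
    (fun rs hrs hmem => by
      exact_mod_cast (length_le_height_of_isWeaklyRegular rs hrs P hmem).trans hPd)
  have hrsm : ∀ r ∈ rs, r ∈ maximalIdeal R := fun r hr => le_maximalIdeal hP.ne_top (hmem r hr)
  have hnt : Nontrivial (R ⧸ (Ideal.ofList rs • ⊤ : Submodule R R)) := by
    apply Submodule.Quotient.nontrivial_iff.2
    rw [smul_eq_mul, Ideal.mul_top]
    exact ne_top_of_le_ne_top hP.ne_top (Ideal.span_le.2 hmem)
  obtain ⟨ts, hts, hlen⟩ := exists_isRegular_of_isLocalRing hpd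
    (projectiveDimension_quotient_ofList hrs hrsm)
  have h3 := length_le_ringKrullDim_quotient_of_isRegular ts _ hts Q hQ
  have h4 := length_le_height_of_isWeaklyRegular rs hrs P hmem
  have h5 : ringKrullDim (R ⧸ Q) ≤ ringKrullDim (R ⧸ P) :=
    ringKrullDim_le_of_surjective (Ideal.Quotient.factor hle) (Ideal.Quotient.factor_surjective hle)
  have h6 := Ideal.height_add_ringKrullDim_quotient_le P
  have h7 := h3.trans h5
  rw [hd] at h6 ⊢
  lift P.height to ℕ using (hPd.trans_lt (ENat.natCast_lt_top d)).ne with p hp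
  obtain ⟨c, hc⟩ : ∃ c : ℕ∞, ringKrullDim (R ⧸ P) = c :=
    ⟨_, (WithBot.coe_unbot _ (ne_bot_of_le_ne_bot (by simp) h7)).symm⟩
  rw [hc] at h6 h7 ⊢
  have hcd : c ≤ d := by
    have := (le_add_of_nonneg_left (by simp) : (c : WithBot ℕ∞) ≤ ((p : ℕ∞) : WithBot ℕ∞) + c).trans h6
    exact_mod_cast this
  lift c to ℕ using (hcd.trans_lt (ENat.natCast_lt_top d)).ne
  norm_cast at h4 h6 h7
  refine ⟨rs, hrs, hmem, ?_, ?_⟩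
  · exact_mod_cast (by omega : rs.length = p)
  · exact_mod_cast (by omega : p + c = d)

/-- The localized residue field has finite projective dimension k, since R/P does. A regular
sequence of length ht P in P gives a quotient of R_P with projective dimension ht P, and the maximal
ideal is associated to that quotient, so its projective dimension is also k. -/
theorem IsRegularLocalRing.projectiveDimension_residueField_localization {R : Type u} [CommRing R]
    [IsRegularLocalRing R] (P : Ideal R) [hP : P.IsPrime] {n : ℕ} (hn : P.height = n) :
    projectiveDimension (ModuleCat.of (Localization.AtPrime P)
      (Localization.AtPrime P ⧸ maximalIdeal (Localization.AtPrime P))) = n := by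
  set A := Localization.AtPrime P with hA
  obtain ⟨rs, hrs, hmem, hlen, -⟩ := IsRegularLocalRing.exists_isWeaklyRegular_height P
  obtain ⟨d, hd⟩ := exists_ringKrullDim_eq_natCast R
  have hpd := IsRegularLocalRing.projectiveDimension_residueField hd
  have : HasProjectiveDimensionLE (ModuleCat.of R (R ⧸ maximalIdeal R)) d :=
    (projectiveDimension_le_iff _ d).1 hpd.le
  have h1 := (projectiveDimension_le_iff _ d).2 (hasProjectiveDimensionLE_of_residueField (R := R)
    d (R ⧸ P))
  have h2 := hrs.isRegular_of_isLocalization_of_mem A P hmem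
  have hmem' : ∀ r ∈ rs.map (algebraMap R A), r ∈ maximalIdeal A := by
    intro r hr
    obtain ⟨s, hs, rfl⟩ := List.mem_map.1 hr
    exact (IsLocalization.AtPrime.to_map_mem_maximal_iff A P s).2 (hmem s hs)
  have h3 := projectiveDimension_quotient_ofList h2.1 hmem'
  have hfin : projectiveDimension (ModuleCat.of A (A ⧸ maximalIdeal A)) ≤ d := by
    have hloc : P.localized' A P.primeCompl (Algebra.linearMap R A) = maximalIdeal A := by
      rw [Ideal.localized'_eq_map]
      exact Localization.AtPrime.map_eq_maximalIdeal
    rw [← hloc]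
    let e := (IsLocalizedModule.linearEquiv P.primeCompl (localizedMk P.primeCompl (R ⧸ P))
      (Submodule.toLocalizedQuotient' A P.primeCompl (Algebra.linearMap R A) P)).extendScalarsOfIsLocalization
        P.primeCompl A
    exact (projectiveDimension_eq_of_iso e.symm.toModuleIso).trans_le
      ((ModuleCat.projectiveDimension_le_projectiveDimension_of_isLocalizedModule P.primeCompl
        (ModuleCat.of R (R ⧸ P))).trans h1)
  obtain ⟨k, hk⟩ : ∃ k : ℕ, projectiveDimension (ModuleCat.of A (A ⧸ maximalIdeal A)) = k := by
    generalize hx : projectiveDimension (ModuleCat.of A (A ⧸ maximalIdeal A)) = x at hfin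
    induction x with
    | bot =>
      rw [projectiveDimension_eq_bot_iff] at hx
      have := ModuleCat.subsingleton_of_isZero hx
      exact absurd this (not_subsingleton_iff_nontrivial.2
        (Ideal.Quotient.nontrivial_iff.2 (maximalIdeal.isMaximal A).ne_top))
    | coe x =>
      have hxd : x ≤ d := by exact_mod_cast hfin
      lift x to ℕ using (hxd.trans_lt (ENat.natCast_lt_top d)).ne
      exact ⟨x, rfl⟩
  have hnt : Nontrivial (A ⧸ (Ideal.ofList (rs.map (algebraMap R A)) • ⊤ : Submodule A A)) :=
    Submodule.Quotient.nontrivial_iff.2 h2.2.symm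
  obtain ⟨q, hq⟩ := associatedPrimes.nonempty A
    (A ⧸ (Ideal.ofList (rs.map (algebraMap R A)) • ⊤ : Submodule A A))
  have hqp := hq.isPrime
  have hrsq : ∀ r ∈ rs.map (algebraMap R A), r ∈ q := by
    intro r hr
    have h : Module.annihilator A
        (A ⧸ (Ideal.ofList (rs.map (algebraMap R A)) • ⊤ : Submodule A A)) ≤ q := by
      rw [← Submodule.annihilator_top]
      exact IsAssociatedPrime.annihilator_le hq
    apply h
    rw [smul_eq_mul, Ideal.mul_top, Ideal.annihilator_quotient]
    exact Ideal.subset_span hr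
  have h4 := length_le_height_of_isWeaklyRegular _ h2.1 q hrsq
  rw [List.length_map, hlen] at h4
  -- An associated prime of the quotient contains a regular sequence of length ht P, so its height
  -- is already that of the maximal ideal.
  have hqm : q = maximalIdeal A := by
    refine Ideal.eq_of_le_of_height_le _ (le_maximalIdeal hqp.ne_top) ?_
    rwa [← WithBot.coe_le_coe, maximalIdeal_height_eq_ringKrullDim,
      IsLocalization.AtPrime.ringKrullDim_eq_height P A, WithBot.coe_le_coe]
  rw [hqm] at hq
  have h5 := projectiveDimension_eq_of_maximalIdeal_mem_associatedPrimes hk _ hq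
  rw [h3, List.length_map] at h5
  rw [hk, ← h5]
  rw [hn] at hlen
  exact_mod_cast hlen

end RegularLocalPrimes

/-! ### Nonvanishing of Hom through associated primes. -/

section AssociatedPrimes

/-- Hom(N, M) vanishes exactly when ann N contains an M-regular element; the zero divisors on M form
the union of its finitely many associated primes, so prime avoidance applies. -/
theorem nontrivial_linearMap_iff {R : Type u} [CommRing R] [IsNoetherianRing R] (N M : Type u)
    [AddCommGroup N] [Module R N] [Module.Finite R N] [AddCommGroup M] [Module R M]
    [Module.Finite R M] :
    Nontrivial (N →ₗ[R] M) ↔ ∃ P ∈ associatedPrimes R M, Module.annihilator R N ≤ P := by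
  rw [← not_subsingleton_iff_nontrivial, IsSMulRegular.subsingleton_linearMap_iff]
  constructor
  · intro h
    by_contra! hQ
    have hsub : ¬ ((Module.annihilator R N : Set R) ⊆ ⋃ Q ∈ associatedPrimes R M, (Q : Set R)) := by
      intro h
      obtain ⟨Q, h1, h2⟩ := (Ideal.subset_union_prime_finite (associatedPrimes.finite R M)
        (f := id) 0 0 fun _ h _ _ ↦ h.isPrime).1 h
      exact hQ Q h1 h2
    rw [biUnion_associatedPrimes_eq_compl_regular R, Set.subset_compl_iff_disjoint_right,
      Set.not_disjoint_iff] at hsub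
    obtain ⟨x, hx, hreg⟩ := hsub
    exact h ⟨x, hx, hreg⟩
  · rintro ⟨P, hP, hle⟩ ⟨r, hr, hreg⟩
    have : r ∈ ⋃ Q ∈ associatedPrimes R M, (Q : Set R) := Set.mem_biUnion hP (hle hr)
    rw [biUnion_associatedPrimes_eq_compl_regular R] at this
    exact this hreg

end AssociatedPrimes

/-! ### Zeroth local cohomology as the colimit of Hom(R/J^n, M). -/

section LocalCohomology

open Limits Opposite

variable {R : Type u} [CommRing R]

instance preservesFiniteColimits_linearYoneda_rightOp (M : ModuleCat.{u} R) :
    PreservesFiniteColimits ((linearYoneda R (ModuleCat.{u} R)).obj M).rightOp := by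
  have : PreservesFiniteLimits ((linearYoneda R (ModuleCat.{u} R)).obj M) := by
    have : PreservesFiniteLimits ((linearYoneda R (ModuleCat.{u} R)).obj M ⋙ forget _) :=
      inferInstanceAs (PreservesFiniteLimits (yoneda.obj M))
    exact preservesFiniteLimits_of_reflects_of_preserves _ (forget _)
  exact preservesFiniteColimits_rightOp _

/-- The diagram of modules whose colimit is `H⁰_J(M)`. -/
noncomputable def localCohZeroDiagram (J : Ideal R) (M : ModuleCat.{u} R) :
    ℕᵒᵖᵒᵖ ⥤ ModuleCat.{u} R :=
  (localCohomology.ringModIdeals (localCohomology.idealPowersDiagram J)).op ⋙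
    (linearYoneda R (ModuleCat.{u} R)).obj M

noncomputable def localCohZeroDiagramIso (J : Ideal R) (M : ModuleCat.{u} R) :
    localCohomology.diagram (localCohomology.idealPowersDiagram J) 0 ⋙
      (evaluation _ _).obj M ≅ localCohZeroDiagram J M :=
  NatIso.ofComponents (fun t => ((Functor.leftDerivedZeroIsoSelf
      ((linearYoneda R (ModuleCat.{u} R)).obj M).rightOp).app
        ((localCohomology.ringModIdeals (localCohomology.idealPowersDiagram J)).obj
          (unop t))).symm.unop) (by
    intro t t' f
    exact congrArg Quiver.Hom.unop ((Functor.leftDerivedZeroIsoSelf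
      ((linearYoneda R (ModuleCat.{u} R)).obj M).rightOp).inv.naturality
        ((localCohomology.ringModIdeals (localCohomology.idealPowersDiagram J)).map f.unop)).symm)

noncomputable def localCohZeroIso (J : Ideal R) (M : Type u) [AddCommGroup M] [Module R M] :
    localCoh J 0 M ≅ colimit (localCohZeroDiagram J (ModuleCat.of R M)) :=
  colimitObjIsoColimitCompEvaluation _ _ ≪≫
    HasColimit.isoOfNatIso (localCohZeroDiagramIso J (ModuleCat.of R M))

/-- A nonzero class yields a nonzero element of M killed by a power of J, and any associated prime
above the annihilator of that element contains J. -/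
theorem nontrivial_localCoh_zero_iff [IsNoetherianRing R] (J : Ideal R) (M : Type u)
    [AddCommGroup M] [Module R M] :
    Nontrivial (localCoh J 0 M) ↔ ∃ P ∈ associatedPrimes R M, J ≤ P := by
  rw [(localCohZeroIso J M).toLinearEquiv.nontrivial_congr]
  set D := localCohZeroDiagram J (ModuleCat.of R M) with hD
  have : PreservesFilteredColimitsOfSize.{0, 0} (forget (ModuleCat.{u} R)) :=
    preservesFilteredColimitsOfSize_shrink _
  constructor
  · intro h
    obtain ⟨x, hx⟩ := exists_ne (0 : ↑(colimit D))
    obtain ⟨t, φ, rfl⟩ := Concrete.colimit_exists_rep D x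
    change ModuleCat.of R (R ⧸ J ^ unop (unop t)) ⟶ ModuleCat.of R M at φ
    let y : M := φ.hom (Submodule.Quotient.mk 1)
    have hy : y ≠ 0 := by
      intro h0
      apply hx
      have : φ = 0 := by
        ext : 1
        refine Submodule.linearMap_qext _ (LinearMap.ext_ring ?_)
        exact h0
      rw [this]
      exact map_zero (colimit.ι D t).hom
    obtain ⟨P, hP, hle⟩ := exists_le_isAssociatedPrime_of_isNoetherianRing R y hy
    have := hP.isPrime
    refine ⟨P, hP, Ideal.IsPrime.le_of_pow_le (n := unop (unop t)) (le_trans (fun a ha => ?_) hle)⟩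
    rw [Submodule.mem_colon_singleton, Submodule.mem_bot]
    change a • φ.hom (Submodule.Quotient.mk 1) = 0
    rw [← map_smul, ← Submodule.Quotient.mk_smul, (Submodule.Quotient.mk_eq_zero _).2 (by simpa using ha),
      map_zero]
  · rintro ⟨P, hP, hle⟩
    obtain ⟨hPp, f, hf⟩ := (isAssociatedPrime_iff_exists_injective_linearMap _ _).1 hP
    -- The class of R/J → R/P ↪ M, at exponent 1, survives in the colimit: all transition maps send
    -- 1 to 1, whose image in M is nonzero.
    have hle' : J ^ 1 ≤ P := by rwa [pow_one]
    let φ : D.obj (op (op 1)) := (ModuleCat.ofHom (f ∘ₗ Submodule.factor hle') :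
      ModuleCat.of R (R ⧸ J ^ 1) ⟶ ModuleCat.of R M)
    refine ⟨⟨colimit.ι D (op (op 1)) φ, 0, fun h => ?_⟩⟩
    obtain ⟨t, g, hg⟩ := Concrete.colimit_rep_eq_zero R D _ φ h
    have h1 : ModuleCat.ofHom (Submodule.mapQ _ _ LinearMap.id
      ((localCohomology.idealPowersDiagram J).map g.unop).down.down) ≫
        ModuleCat.ofHom (f ∘ₗ Submodule.factor hle') = 0 := hg
    have h2 : f (Submodule.Quotient.mk 1) = 0 :=
      LinearMap.congr_fun (congrArg ModuleCat.Hom.hom h1) (Submodule.Quotient.mk 1)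
    rw [← map_zero f] at h2
    have h3 := (Submodule.Quotient.mk_eq_zero _).1 (hf h2)
    exact hPp.ne_top ((Ideal.eq_top_iff_one P).2 h3)

end LocalCohomology

/-! ### The equivalences, given the dimension formula and the local projective dimensions. -/

section Core

open IsLocalRing

variable {S : Type u} [CommRing S] [IsNoetherianRing S] {M : Type u} [AddCommGroup M] [Module S M]
  [Module.Finite S M] {e : ℕ}

instance finite_localizedModule (T : Submonoid S) :
    Module.Finite (Localization T) ((ModuleCat.of S M).localizedModule T) :=
  Module.Finite.of_isLocalizedModule T (localizedMk T M)

omit [IsNoetherianRing S] [Module.Finite S M] in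
theorem isScalarTower_localizedModule_atPrime (P : Ideal S) [P.IsPrime] :
    IsScalarTower S (Localization.AtPrime P) ((ModuleCat.of S M).localizedModule P.primeCompl) :=
  inferInstanceAs (IsScalarTower S (Localization P.primeCompl)
    ((ModuleCat.of S M).localizedModule P.primeCompl))

theorem projectiveDimension_localizedModule_of_mem_associatedPrimes {P : Ideal S} [P.IsPrime]
    {n : ℕ} (hn : projectiveDimension (ModuleCat.of (Localization.AtPrime P)
      (Localization.AtPrime P ⧸ maximalIdeal (Localization.AtPrime P))) = n)
    (hP : P ∈ associatedPrimes S M) :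
    projectiveDimension ((ModuleCat.of S M).localizedModule P.primeCompl) = n := by
  have := isScalarTower_localizedModule_atPrime (M := M) P
  refine projectiveDimension_eq_of_maximalIdeal_mem_associatedPrimes hn
    ((ModuleCat.of S M).localizedModule P.primeCompl) ?_
  apply Module.associatedPrimes.mem_associatedPrimes_of_comap_mem_associatedPrimes_of_isLocalizedModule
    P.primeCompl (localizedMk P.primeCompl M)
  have : (maximalIdeal (Localization.AtPrime P)).comap (algebraMap S (Localization.AtPrime P)) = P :=
    IsLocalization.AtPrime.under_maximalIdeal _ P
  rwa [this]

theorem height_le_and_annihilator_extSelf_le_iff (hM : projectiveDimension (ModuleCat.of S M) = e)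
    {P : Ideal S} [P.IsPrime] {n : ℕ} (hn : projectiveDimension (ModuleCat.of (Localization.AtPrime P)
      (Localization.AtPrime P ⧸ maximalIdeal (Localization.AtPrime P))) = n)
    (hP : P ∈ associatedPrimes S M) :
    n ≤ e ∧ (Module.annihilator S (ExtSelf S M e) ≤ P ↔ n = e) := by
  have : HasProjectiveDimensionLE (ModuleCat.of S M) e := (projectiveDimension_le_iff _ e).1 hM.le
  have h1 := projectiveDimension_localizedModule_of_mem_associatedPrimes hn hP
  have h2 := ModuleCat.projectiveDimension_le_projectiveDimension_of_isLocalizedModule P.primeCompl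
    (ModuleCat.of S M)
  rw [h1, hM] at h2
  have h3 : n ≤ e := by exact_mod_cast h2
  refine ⟨h3, ?_⟩
  rw [annihilator_extSelf_le_iff, ← projectiveDimension_ge_iff, h1]
  constructor
  · intro h
    have : e ≤ n := by exact_mod_cast h
    omega
  · rintro rfl
    exact le_rfl

/-- Common to both kinds of ring. With depth M = d - e and dim S/P = d - ht P, the equality in
condition 1 says that the bound ht P ≤ e is attained on Ass M. -/
theorem tfae_of_height_add_dim (𝔪 : Ideal S) [𝔪.IsPrime] [𝔪.IsMaximal]
    (hM : projectiveDimension (ModuleCat.of S M) = e) {d : ℕ} (hd : 𝔪.height = d)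
    (hgood : ∀ (P : Ideal S) [P.IsPrime] (n : ℕ), P.height = n →
      projectiveDimension (ModuleCat.of (Localization.AtPrime P)
        (Localization.AtPrime P ⧸ maximalIdeal (Localization.AtPrime P))) = n)
    (hdim : ∀ P ∈ associatedPrimes S M,
      (P.height : WithBot ℕ∞) + ringKrullDim (S ⧸ P) = 𝔪.height)
    (hloc : projectiveDimension ((ModuleCat.of S M).localizedModule 𝔪.primeCompl) = e)
    (hTor : Nontrivial (TorMod S e M M) ↔ Nontrivial (ExtSelf S M e →ₗ[S] M)) :
    List.TFAE
      [((depthAt 𝔪 M : ℕ∞) : WithBot ℕ∞) = omegaInv S M,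
        Nontrivial (localCoh (Module.annihilator S (ExtSelf S M e)) 0 M),
        Nontrivial (ExtSelf S M e →ₗ[S] M),
        Nontrivial (TorMod S e M M)] := by
  have hne : Nontrivial ((ModuleCat.of S M).localizedModule 𝔪.primeCompl) := by
    by_contra h
    rw [not_nontrivial_iff_subsingleton] at h
    have h1 : projectiveDimension ((ModuleCat.of S M).localizedModule 𝔪.primeCompl) = ⊥ :=
      (projectiveDimension_eq_bot_iff _).2 (ModuleCat.isZero_of_subsingleton _)
    rw [hloc] at h1
    exact absurd h1 (by simp)
  have := isScalarTower_localizedModule_atPrime (M := M) 𝔪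
  have hloc' : projectiveDimension (ModuleCat.of (Localization.AtPrime 𝔪)
      ((ModuleCat.of S M).localizedModule 𝔪.primeCompl)) = e := hloc
  have hfin' : Module.Finite (Localization.AtPrime 𝔪)
      ((ModuleCat.of S M).localizedModule 𝔪.primeCompl) := finite_localizedModule 𝔪.primeCompl
  obtain ⟨l, hl, hel⟩ := depthAt_eq 𝔪 (Localization.AtPrime 𝔪)
    (M' := (ModuleCat.of S M).localizedModule 𝔪.primeCompl) (localizedMk 𝔪.primeCompl M)
    (hgood 𝔪 d hd) hloc'
  have hmem : ∀ P ∈ associatedPrimes S M, ∃ n c : ℕ, P.height = n ∧ ringKrullDim (S ⧸ P) = c ∧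
      n + c = d ∧ n ≤ e ∧ (Module.annihilator S (ExtSelf S M e) ≤ P ↔ n = e) := by
    intro P hP
    have hPp := hP.isPrime
    have h1 := hdim P hP
    obtain ⟨c, hc⟩ : ∃ c : ℕ∞, ringKrullDim (S ⧸ P) = c :=
      ⟨_, (WithBot.coe_unbot _ (ne_bot_of_le_ne_bot (by simp)
        (ringKrullDim_nonneg_of_nontrivial (R := S ⧸ P)))).symm⟩
    rw [hc, hd] at h1
    norm_cast at h1
    have hn : P.height ≠ ⊤ := by rintro h; rw [h] at h1; simp at h1
    have hc' : c ≠ ⊤ := by rintro rfl; simp at h1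
    lift c to ℕ using hc'
    obtain ⟨n, hn⟩ := ENat.ne_top_iff_exists.1 hn
    have := height_le_and_annihilator_extSelf_le_iff hM (hgood P n hn.symm) hP
    rw [← hn] at h1
    exact ⟨n, c, hn.symm, hc, by exact_mod_cast h1, this⟩
  have hfin : Module.Finite S (ExtSelf S M e) := ModuleCat.finite_ext S (ModuleCat.of S M) (ModuleCat.of S S) e
  have hMne : Nontrivial M := by
    by_contra h
    rw [not_nontrivial_iff_subsingleton] at h
    have h1 : projectiveDimension (ModuleCat.of S M) = ⊥ :=
      (projectiveDimension_eq_bot_iff _).2 (ModuleCat.isZero_of_subsingleton _)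
    rw [hM] at h1
    exact absurd h1 (by simp)
  tfae_have 3 ↔ 4 := hTor.symm
  tfae_have 2 ↔ 3 := by rw [nontrivial_localCoh_zero_iff, nontrivial_linearMap_iff]
  tfae_have 1 ↔ 2 := by
    rw [nontrivial_localCoh_zero_iff, hl]
    have hset : ({c | ∃ P ∈ associatedPrimes S M, c = ringKrullDim (S ⧸ P)} :
        Set (WithBot ℕ∞)).Nonempty := by
      obtain ⟨P, hP⟩ := associatedPrimes.nonempty S M
      exact ⟨_, P, hP, rfl⟩
    constructor
    · intro h
      obtain ⟨P, hP, hPd⟩ := csInf_mem hset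
      obtain ⟨n, c, hn, hc, hnc, hne, hiff⟩ := hmem P hP
      refine ⟨P, hP, hiff.2 ?_⟩
      have : ((l : ℕ∞) : WithBot ℕ∞) = (c : ℕ∞) := by
        rw [h, omegaInv, hPd, hc]; rfl
      have : l = c := by exact_mod_cast this
      omega
    · rintro ⟨P, hP, hle⟩
      obtain ⟨n, c, hn, hc, hnc, hne, hiff⟩ := hmem P hP
      have h1 := hiff.1 hle
      have hlc : l = c := by omega
      apply le_antisymm
      · refine le_csInf hset ?_
        rintro _ ⟨P', hP', rfl⟩
        obtain ⟨n', c', -, hc', hnc', hne', -⟩ := hmem P' hP'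
        rw [hc']
        exact_mod_cast (by omega : l ≤ c')
      · refine csInf_le (OrderBot.bddBelow _) ⟨P, hP, ?_⟩
        rw [hc, hlc]; rfl
  tfae_finish

end Core

/-! ### The regular local case. -/

section RegularLocalCase

open IsLocalRing

theorem tfae_of_isRegularLocalRing {S : Type u} [CommRing S] [IsRegularLocalRing S]
    {M : Type u} [AddCommGroup M] [Module S M] [Module.Finite S M] {e : ℕ}
    (hM : projectiveDimension (ModuleCat.of S M) = e)
    (hTor : Nontrivial (TorMod S e M M) ↔ Nontrivial (ExtSelf S M e →ₗ[S] M)) :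
    List.TFAE
      [((depthAt (maximalIdeal S) M : ℕ∞) : WithBot ℕ∞) = omegaInv S M,
        Nontrivial (localCoh (Module.annihilator S (ExtSelf S M e)) 0 M),
        Nontrivial (ExtSelf S M e →ₗ[S] M),
        Nontrivial (TorMod S e M M)] := by
  obtain ⟨d, hd⟩ := exists_ringKrullDim_eq_natCast S
  refine tfae_of_height_add_dim (maximalIdeal S) hM (d := d) ?_
    (fun P _ n hn => IsRegularLocalRing.projectiveDimension_residueField_localization P hn) ?_ ?_ hTor
  · rw [← maximalIdeal_height_eq_ringKrullDim] at hd
    exact_mod_cast hd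
  · intro P hP
    have := hP.isPrime
    obtain ⟨-, -, -, -, h⟩ := IsRegularLocalRing.exists_isWeaklyRegular_height P
    rw [h, maximalIdeal_height_eq_ringKrullDim]
  · rw [← hM, ModuleCat.projectiveDimension_eq_iSup_localizedModule_maximal (ModuleCat.of S M)]
    refine le_antisymm (le_iSup (fun p : MaximalSpectrum S =>
      projectiveDimension ((ModuleCat.of S M).localizedModule p.1.primeCompl))
        ⟨maximalIdeal S, inferInstance⟩) (iSup_le fun p => ?_)
    obtain ⟨p, hp⟩ := p
    obtain rfl := eq_maximalIdeal hp
    exact le_rfl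

end RegularLocalCase

/-! ### Dimension shifting for the vanishing of left derived functors. -/

section DerivedFunctors

open Limits

variable {C : Type u} [Category.{v} C] [Abelian C]

theorem mono_iff_exact_comp_of_exact {A B K P : C} (a : A ⟶ B) (e : B ⟶ K) (m : K ⟶ P) [Epi e]
    (w : a ≫ e = 0) (hex : (ShortComplex.mk a e w).Exact) :
    (ShortComplex.mk a (e ≫ m) (by rw [reassoc_of% w, zero_comp])).Exact ↔ Mono m := by
  constructor
  · intro h
    refine Preadditive.mono_of_cancel_zero _ fun t ht => ?_
    obtain ⟨A', π, _, y, hy⟩ := surjective_up_to_refinements_of_epi e t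
    obtain ⟨A'', π', _, x, hx⟩ := h.exact_up_to_refinements y (by
      dsimp; rw [← Category.assoc, ← hy, Category.assoc, ht, comp_zero])
    dsimp at hx
    rw [← cancel_epi π, ← cancel_epi π', comp_zero, comp_zero, hy, reassoc_of% hx, w, comp_zero]
  · intro h
    let φ : ShortComplex.mk a e w ⟶ ShortComplex.mk a (e ≫ m) (by rw [reassoc_of% w, zero_comp]) :=
      { τ₁ := 𝟙 _, τ₂ := 𝟙 _, τ₃ := m }
    have : Epi φ.τ₁ := inferInstanceAs (Epi (𝟙 A))
    have : IsIso φ.τ₂ := inferInstanceAs (IsIso (𝟙 B))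
    have : Mono φ.τ₃ := h
    exact (ShortComplex.exact_iff_of_epi_of_isIso_of_mono φ).1 hex

theorem exactAt_mapHomologicalComplex_iff {D : Type*} [Category* D] [Abelian D] (F : C ⥤ D)
    [F.Additive] (K : ChainComplex C ℕ) (n : ℕ) :
    ((F.mapHomologicalComplex _).obj K).ExactAt (n + 1) ↔
      (ShortComplex.mk (F.map (K.d (n + 2) (n + 1))) (F.map (K.d (n + 1) n))
        (by rw [← F.map_comp, K.d_comp_d, F.map_zero])).Exact :=
  HomologicalComplex.exactAt_iff' _ (n + 2) (n + 1) n (by simp) (by simp)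

theorem isZero_leftDerived_succ_iff {D : Type*} [Category* D] [Abelian D]
    [HasProjectiveResolutions C] (F : C ⥤ D)
    [F.Additive] {X : C} (P : ProjectiveResolution X) (n : ℕ) :
    IsZero ((F.leftDerived (n + 1)).obj X) ↔
      (ShortComplex.mk (F.map (P.complex.d (n + 2) (n + 1))) (F.map (P.complex.d (n + 1) n))
        (by rw [← F.map_comp, P.complex.d_comp_d, F.map_zero])).Exact := by
  rw [(P.isoLeftDerivedObj F (n + 1)).isZero_iff, ← exactAt_mapHomologicalComplex_iff]
  exact (HomologicalComplex.exactAt_iff_isZero_homology _ _).symm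

namespace CategoryTheory.ProjectiveResolution

/-- The augmentation map of a projective resolution. -/
noncomputable def augmentation {X : C} (Q : ProjectiveResolution X) : Q.complex.X 0 ⟶ X := Q.π.f 0

instance {X : C} (Q : ProjectiveResolution X) : Epi Q.augmentation :=
  inferInstanceAs (Epi (Q.π.f 0))

theorem d_comp_augmentation {X : C} (Q : ProjectiveResolution X) :
    Q.complex.d 1 0 ≫ Q.augmentation = 0 := Q.complex_d_comp_π_f_zero

theorem exact_d_augmentation {X : C} (Q : ProjectiveResolution X) :
    (ShortComplex.mk (Q.complex.d 1 0) Q.augmentation Q.d_comp_augmentation).Exact :=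
  Q.exact₀

variable {S : ShortComplex C} (hS : S.ShortExact)

theorem d_comp_augmentation_comp (Q : ProjectiveResolution S.X₁) :
    Q.complex.d 1 0 ≫ Q.augmentation ≫ S.f = 0 := by
  rw [← Category.assoc, d_comp_augmentation, zero_comp]

include hS in
theorem exact_d_augmentation_comp (Q : ProjectiveResolution S.X₁) :
    (ShortComplex.mk (Q.complex.d 1 0) (Q.augmentation ≫ S.f)
      Q.d_comp_augmentation_comp).Exact :=
  (mono_iff_exact_comp_of_exact _ _ S.f _ Q.exact_d_augmentation).2 hS.mono_f

theorem augmentation_comp_comp {S : ShortComplex C} (Q : ProjectiveResolution S.X₁) :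
    (Q.augmentation ≫ S.f) ≫ S.g = 0 := by
  simp

include hS in
theorem exact_augmentation_comp (Q : ProjectiveResolution S.X₁) :
    (ShortComplex.mk (Q.augmentation ≫ S.f) S.g (by simp)).Exact := by
  let φ : ShortComplex.mk (Q.augmentation ≫ S.f) S.g (by simp) ⟶ S :=
    { τ₁ := Q.augmentation, τ₂ := 𝟙 _, τ₃ := 𝟙 _ }
  have : Epi φ.τ₁ := inferInstanceAs (Epi Q.augmentation)
  have : IsIso φ.τ₂ := inferInstanceAs (IsIso (𝟙 S.X₂))
  have : Mono φ.τ₃ := inferInstanceAs (Mono (𝟙 S.X₃))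
  exact (ShortComplex.exact_iff_of_epi_of_isIso_of_mono φ).2 hS.exact

/-- The projective resolution of `S.X₃` obtained by splicing a resolution of `S.X₁` with the
short exact sequence `S` whose middle term is projective. -/
noncomputable def splice [Projective S.X₂] (Q : ProjectiveResolution S.X₁) :
    ProjectiveResolution S.X₃ where
  complex := Q.complex.augment (Q.augmentation ≫ S.f) Q.d_comp_augmentation_comp
  projective n := by
    cases n
    · exact inferInstanceAs (Projective S.X₂)
    · exact Q.projective _
  π := (ChainComplex.toSingle₀Equiv _ _).symm ⟨S.g, augmentation_comp_comp Q⟩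
  quasiIso := ⟨fun n => by
    rcases n with _ | n
    · rw [ChainComplex.quasiIsoAt₀_iff, ShortComplex.quasiIso_iff_of_zeros']
      · have := hS.epi_g
        dsimp
        refine (ShortComplex.exact_and_epi_g_iff_of_iso ?_).2
          ⟨Q.exact_augmentation_comp hS, this⟩
        exact ShortComplex.isoMk (Iso.refl _) (Iso.refl _) (Iso.refl _) 
          ((Category.id_comp _).trans (Category.comp_id _).symm)
          ((Category.id_comp S.g).trans ((ChainComplex.toSingle₀Equiv_symm_apply_f_zero
            (C := Q.complex.augment (Q.augmentation ≫ S.f) Q.d_comp_augmentation_comp)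
            S.g (augmentation_comp_comp Q)).symm.trans (Category.comp_id _).symm))
      all_goals rfl
    · rw [quasiIsoAt_iff_exactAt']
      · rw [HomologicalComplex.exactAt_iff' _ (n + 1 + 1) (n + 1) n (by simp) (by simp)]
        cases n
        · exact Q.exact_d_augmentation_comp hS
        · exact Q.exact_succ _
      · apply ChainComplex.exactAt_succ_single_obj⟩

end CategoryTheory.ProjectiveResolution

variable {S : ShortComplex C} (hS : S.ShortExact)

variable {D : Type*} [Category* D] [Abelian D] [HasProjectiveResolutions C] (F : C ⥤ D)
  [F.Additive]

-- The spliced resolution of `S.X₃` is the resolution of `S.X₁` moved up by one, so both sides are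
-- exactness of the same complex.
include hS in
theorem isZero_leftDerived_add_two_iff [Projective S.X₂] (n : ℕ) :
    IsZero ((F.leftDerived (n + 2)).obj S.X₃) ↔ IsZero ((F.leftDerived (n + 1)).obj S.X₁) := by
  let Q := projectiveResolution S.X₁
  rw [isZero_leftDerived_succ_iff F (Q.splice hS), isZero_leftDerived_succ_iff F Q]
  rfl

-- By right exactness `F.map S.X₁` is the cokernel of the first differential; exactness of the
-- spliced complex at that spot then amounts to injectivity on this cokernel.
include hS in
theorem isZero_leftDerived_one_iff [Projective S.X₂] [PreservesFiniteColimits F] :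
    IsZero ((F.leftDerived 1).obj S.X₃) ↔ Mono (F.map S.f) := by
  let Q := projectiveResolution S.X₁
  rw [isZero_leftDerived_succ_iff F (Q.splice hS) 0]
  have h : (ShortComplex.mk (F.map (Q.complex.d 1 0)) (F.map Q.augmentation)
      (by rw [← F.map_comp, Q.d_comp_augmentation, F.map_zero])).Exact :=
    Q.exact_d_augmentation.map_of_epi_of_preservesCokernel F inferInstance inferInstance
  rw [← mono_iff_exact_comp_of_exact _ _ (F.map S.f) _ h]
  apply ShortComplex.exact_iff_of_iso
  exact ShortComplex.isoMk (Iso.refl _) (Iso.refl _) (Iso.refl _) (by simp [ProjectiveResolution.splice])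
    (by simp [ProjectiveResolution.splice])

end DerivedFunctors

/-! ### The last Tor against Hom out of the last Ext. -/

section TorAndExt

open Limits Abelian TensorProduct MonoidalCategory

variable {S : Type u} [CommRing S]

/-- `N ⊗ M ≃ Hom(M*, N)` for a finite projective module `M`. -/
noncomputable def tensorEquivDualHom (N M : Type u) [AddCommGroup N] [Module S N] [AddCommGroup M]
    [Module S M] [Module.Finite S M] [Module.Projective S M] :
    N ⊗[S] M ≃ₗ[S] (Module.Dual S M →ₗ[S] N) :=
  TensorProduct.comm S N M ≪≫ₗ (Module.evalEquiv S M).rTensor N ≪≫ₗ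
    dualTensorHomEquiv S (Module.Dual S M) N

theorem tensorEquivDualHom_tmul {N M : Type u} [AddCommGroup N] [Module S N] [AddCommGroup M]
    [Module S M] [Module.Finite S M] [Module.Projective S M] (n : N) (m : M)
    (f : Module.Dual S M) : tensorEquivDualHom N M (n ⊗ₜ m) f = f m • n := by
  simp [tensorEquivDualHom, dualTensorHomEquiv]

theorem tensorEquivDualHom_lTensor {N K F : Type u} [AddCommGroup N] [Module S N] [AddCommGroup K]
    [Module S K] [Module.Finite S K] [Module.Projective S K] [AddCommGroup F]
    [Module S F] [Module.Finite S F] [Module.Projective S F] (i : K →ₗ[S] F) (x : N ⊗[S] K) :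
    tensorEquivDualHom N F (i.lTensor N x) = tensorEquivDualHom N K x ∘ₗ i.dualMap := by
  induction x with
  | zero => simp
  | add x y hx hy => rw [map_add, map_add, map_add, hx, hy, LinearMap.add_comp]
  | tmul n k =>
    ext f
    simp [tensorEquivDualHom_tmul]

instance preservesFiniteColimits_tensoringLeft_obj (N : ModuleCat.{u} S) :
    PreservesFiniteColimits ((tensoringLeft (ModuleCat.{u} S)).obj N) :=
  inferInstanceAs (PreservesFiniteColimits (tensorLeft N))

/-- The connecting map `Hom(ker g, S) → Ext¹(M, S)`. -/
noncomputable def dualKerToExt {F M : Type u} [AddCommGroup F] [Module S F] [AddCommGroup M]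
    [Module S M] (g : F →ₗ[S] M) (hg : Function.Surjective g) :
    Module.Dual S (LinearMap.ker g) →ₗ[S] ExtSelf S M 1 :=
  ((LinearMap.shortExact_shortComplexKer hg).extClass.precompOfLinear S (ModuleCat.of S S)
    (add_zero 1)) ∘ₗ (Ext.linearEquiv₀ (R := S) ≪≫ₗ ModuleCat.homLinearEquiv).symm.toLinearMap

theorem dualKerToExt_surjective {F M : Type u} [AddCommGroup F] [Module S F] [AddCommGroup M]
    [Module S M] [Module.Projective S F] (g : F →ₗ[S] M) (hg : Function.Surjective g) :
    Function.Surjective (dualKerToExt g hg) := by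
  have : Projective (ModuleCat.of S F) := ModuleCat.projective_of_categoryTheory_projective _
  refine Function.Surjective.comp (g := (LinearMap.shortExact_shortComplexKer hg).extClass.precompOfLinear S (ModuleCat.of S S)
    (add_zero 1)) (fun x => ?_) (LinearEquiv.surjective _)
  exact Ext.contravariant_sequence_exact₃ (LinearMap.shortExact_shortComplexKer hg) _ x
    (Ext.eq_zero_of_projective _) (add_zero 1)

theorem dualKerToExt_eq_zero_iff {F M : Type u} [AddCommGroup F] [Module S F] [AddCommGroup M]
    [Module S M] (g : F →ₗ[S] M) (hg : Function.Surjective g)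
    (f : Module.Dual S (LinearMap.ker g)) :
    dualKerToExt g hg f = 0 ↔ ∃ f' : Module.Dual S F, (LinearMap.ker g).subtype.dualMap f' = f := by
  have hS := LinearMap.shortExact_shortComplexKer hg
  have hf : dualKerToExt g hg f = hS.extClass.comp (Ext.mk₀ (ModuleCat.ofHom f)) (add_zero 1) := rfl
  rw [hf]
  constructor
  · intro h
    obtain ⟨y, hy⟩ := Ext.contravariant_sequence_exact₁ hS _ _ (add_zero 1) h
    obtain ⟨f', rfl⟩ := (Ext.mk₀_bijective _ _).2 y
    rw [Ext.mk₀_comp_mk₀, (Ext.mk₀_bijective _ _).1.eq_iff] at hy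
    exact ⟨f'.hom, congrArg ModuleCat.Hom.hom hy⟩
  · rintro ⟨f', rfl⟩
    have : Ext.mk₀ (ModuleCat.ofHom ((LinearMap.ker g).subtype.dualMap f')) =
        (Ext.mk₀ (LinearMap.shortComplexKer g).f).comp (Ext.mk₀ (ModuleCat.ofHom f')) (zero_add 0) := by
      rw [Ext.mk₀_comp_mk₀]; rfl
    rw [this, hS.extClass_comp_assoc]

/-- Under N ⊗ K = Hom(K*, N) the map becomes precomposition with F* → K*, where K = ker g. The
cokernel of F* → K* is Ext¹(M, S), so the kernel in question is Hom(Ext¹(M, S), N). -/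
theorem injective_lTensor_ker_iff (N : Type u) [AddCommGroup N] [Module S N] {F M : Type u}
    [AddCommGroup F] [Module S F] [Module.Finite S F] [Module.Projective S F] [AddCommGroup M]
    [Module S M] (g : F →ₗ[S] M) (hg : Function.Surjective g)
    [Module.Finite S (LinearMap.ker g)] [Module.Projective S (LinearMap.ker g)] :
    Function.Injective ((LinearMap.ker g).subtype.lTensor N) ↔
      Subsingleton (ExtSelf S M 1 →ₗ[S] N) := by
  have hex : Function.Exact (LinearMap.ker g).subtype.dualMap (dualKerToExt g hg) :=
    dualKerToExt_eq_zero_iff g hg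
  have hsurj := dualKerToExt_surjective g hg
  constructor
  · intro h
    refine ⟨fun φ ψ => ?_⟩
    rw [← sub_eq_zero]
    set χ := φ - ψ
    obtain ⟨x, hx⟩ := (tensorEquivDualHom N (LinearMap.ker g)).surjective (χ ∘ₗ dualKerToExt g hg)
    have h1 : (LinearMap.ker g).subtype.lTensor N x = 0 := by
      apply (tensorEquivDualHom N F).injective
      rw [tensorEquivDualHom_lTensor, hx, LinearMap.comp_assoc, hex.linearMap_comp_eq_zero,
        LinearMap.comp_zero, map_zero]
    have h2 : x = 0 := h (by rw [h1, map_zero])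
    rw [h2, map_zero] at hx
    ext y
    obtain ⟨f, rfl⟩ := hsurj y
    exact (LinearMap.congr_fun hx f).symm
  · intro h
    rw [injective_iff_map_eq_zero]
    intro x hx
    have h1 := tensorEquivDualHom_lTensor (LinearMap.ker g).subtype x
    rw [hx, map_zero] at h1
    obtain ⟨φ, hφ⟩ : ∃ φ : ExtSelf S M 1 →ₗ[S] N,
        φ ∘ₗ dualKerToExt g hg = tensorEquivDualHom N (LinearMap.ker g) x := by
      have hle : LinearMap.ker (dualKerToExt g hg) ≤
          LinearMap.ker (tensorEquivDualHom N (LinearMap.ker g) x) := by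
        intro f hf
        obtain ⟨f', rfl⟩ := (hex f).1 hf
        exact (LinearMap.congr_fun h1 f').symm
      refine ⟨(LinearMap.ker (dualKerToExt g hg)).liftQ _ hle ∘ₗ
        ((dualKerToExt g hg).quotKerEquivOfSurjective hsurj).symm.toLinearMap, ?_⟩
      ext f
      have : ((dualKerToExt g hg).quotKerEquivOfSurjective hsurj).symm (dualKerToExt g hg f) =
          Submodule.Quotient.mk f := by
        rw [LinearEquiv.symm_apply_eq]
        rfl
      simp only [LinearMap.comp_apply, LinearEquiv.coe_coe, this]
      rfl
    rw [Subsingleton.elim φ 0, LinearMap.zero_comp] at hφ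
    exact (LinearEquiv.map_eq_zero_iff _).1 hφ.symm

theorem nontrivial_iff_not_isZero (X : ModuleCat.{u} S) : Nontrivial X ↔ ¬ IsZero X := by
  rw [← not_subsingleton_iff_nontrivial]
  exact not_congr ⟨fun _ => ModuleCat.isZero_of_subsingleton _, ModuleCat.subsingleton_of_isZero⟩

/-- Tor and Ext shift together along ker g until projective dimension at most 1 remains, where the
duality for finite projectives decides; for e = 0 it applies to M itself. -/
theorem nontrivial_torMod_iff [IsNoetherianRing S] (N : Type u) [AddCommGroup N] [Module S N]
    (M : Type u) [AddCommGroup M] [Module S M] [Module.Finite S M] (e : ℕ)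
    [HasProjectiveDimensionLE (ModuleCat.of S M) e] :
    Nontrivial (TorMod S e N M) ↔ Nontrivial (ExtSelf S M e →ₗ[S] N) := by
  induction e using Nat.twoStepInduction generalizing M with
  | zero =>
    have : Module.Projective S M := by
      rw [IsProjective.iff_projective, projective_iff_hasProjectiveDimensionLT_one]
      assumption
    have e1 : TorMod S 0 N M ≃ₗ[S] N ⊗[S] M :=
      ((Functor.leftDerivedZeroIsoSelf ((tensoringLeft (ModuleCat.{u} S)).obj (ModuleCat.of S N))).app
        (ModuleCat.of S M)).toLinearEquiv
    have e2 : (ExtSelf S M 0 →ₗ[S] N) ≃ₗ[S] (Module.Dual S M →ₗ[S] N) :=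
      (Ext.linearEquiv₀ (R := S) ≪≫ₗ ModuleCat.homLinearEquiv).congrLeft _ _
    rw [(e1 ≪≫ₗ tensorEquivDualHom N M ≪≫ₗ e2.symm).nontrivial_congr]
  | one =>
    obtain ⟨F, _, _, _, _, g, hg⟩ := Module.exists_finite_presentation S M
    have hS := LinearMap.shortExact_shortComplexKer hg
    have hF : Projective (LinearMap.shortComplexKer g).X₂ :=
      ModuleCat.projective_of_categoryTheory_projective (ModuleCat.of S F)
    have : Module.Projective S (LinearMap.ker g) := by
      rw [IsProjective.iff_projective, projective_iff_hasProjectiveDimensionLT_one]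
      exact (hS.hasProjectiveDimensionLT_X₃_iff 0 hF).1 inferInstance
    rw [nontrivial_iff_not_isZero, ← not_subsingleton_iff_nontrivial,
      ← injective_lTensor_ker_iff N g hg]
    refine not_congr ((isZero_leftDerived_one_iff hS
      ((tensoringLeft (ModuleCat.{u} S)).obj (ModuleCat.of S N))).trans ?_)
    exact ModuleCat.mono_iff_injective _
  | more n _ ih =>
    obtain ⟨F, _, _, _, _, g, hg⟩ := Module.exists_finite_presentation S M
    have hS := LinearMap.shortExact_shortComplexKer hg
    have hF : Projective (LinearMap.shortComplexKer g).X₂ :=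
      ModuleCat.projective_of_categoryTheory_projective (ModuleCat.of S F)
    have : HasProjectiveDimensionLE (ModuleCat.of S (LinearMap.ker g)) (n + 1) :=
      (hS.hasProjectiveDimensionLT_X₃_iff (n + 1) hF).1 inferInstance
    have e1 : (ExtSelf S (LinearMap.ker g) (n + 1) →ₗ[S] N) ≃ₗ[S]
      (ExtSelf S M (n + 2) →ₗ[S] N) := (extShift g hg (ModuleCat.of S S) n).congrLeft _ _
    rw [← e1.nontrivial_congr, ← ih (LinearMap.ker g), nontrivial_iff_not_isZero,
      nontrivial_iff_not_isZero]
    exact not_congr (isZero_leftDerived_add_two_iff hS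
      ((tensoringLeft (ModuleCat.{u} S)).obj (ModuleCat.of S N)) n)

end TorAndExt

/-! ### Graded modules and the action of elements with unit degree-zero component. -/

section ModuleGradings

variable {k : Type v} {S : Type u} [CommRing S] [Field k] [Algebra k S] (𝒜 : ℕ → Submodule k S)
  [GradedAlgebra 𝒜]

/-- A grading of the `S`-module `M` by the integers, compatible with the grading `𝒜` of `S`, given
by the projections to the homogeneous components. -/
structure ModuleGrading (M : Type u) [AddCommGroup M] [Module S M] where
  proj : ℤ → M →+ M
  finite_support : ∀ m, (Function.support fun j => proj j m).Finite
  finsum_proj : ∀ m, ∑ᶠ j, proj j m = m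
  proj_proj : ∀ i j m, proj i (proj j m) = if i = j then proj j m else 0
  proj_smul : ∀ (i : ℕ), ∀ a ∈ 𝒜 i, ∀ (j : ℤ) (m : M), proj (i + j) (a • m) = a • proj j m

namespace ModuleGrading

variable {𝒜} {M : Type u} [AddCommGroup M] [Module S M] (G : ModuleGrading 𝒜 M)

omit [GradedAlgebra 𝒜] in
theorem proj_smul' (i : ℕ) (a : S) (ha : a ∈ 𝒜 i) (j : ℤ) (m : M) :
    G.proj j (a • m) = a • G.proj (j - i) m := by
  rw [← G.proj_smul i a ha, add_sub_cancel]

theorem proj_smul_eq_sum (j : ℤ) (s : S) (m : M) [∀ i (x : 𝒜 i), Decidable (x ≠ 0)] :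
    G.proj j (s • m) = ∑ i ∈ (DirectSum.decompose 𝒜 s).support,
      (DirectSum.decompose 𝒜 s i : S) • G.proj (j - i) m := by
  conv_lhs => rw [← DirectSum.sum_support_decompose 𝒜 s, Finset.sum_smul, map_sum]
  exact Finset.sum_congr rfl fun i _ => G.proj_smul' i _ (SetLike.coe_mem _) j m

/-- `S` has no negative degrees, so only the degree-zero part of `s` contributes to the lowest
component. -/
theorem proj_smul_of_forall_lt (j : ℤ) (s : S) (m : M) (h : ∀ i < j, G.proj i m = 0) :
    G.proj j (s • m) = GradedRing.proj 𝒜 0 s • G.proj j m := by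
  classical
  rw [proj_smul_eq_sum, Finset.sum_eq_single 0]
  · simp [GradedRing.proj_apply]
  · intro i _ hi
    rw [h _ (by omega), smul_zero]
  · intro h0
    rw [DFinsupp.notMem_support_iff.1 h0]
    simp

include G in
theorem smul_eq_zero_of_isUnit {s : S} (hs : IsUnit (GradedRing.proj 𝒜 0 s)) {m : M}
    (h : s • m = 0) : m = 0 := by
  by_contra hm
  have hne : (G.finite_support m).toFinset.Nonempty := by
    rw [Set.Finite.toFinset_nonempty, Set.nonempty_iff_ne_empty]
    intro he
    apply hm
    rw [← G.finsum_proj m]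
    exact finsum_eq_zero_of_forall_eq_zero fun j => by
      by_contra hj
      exact Set.notMem_empty j (he ▸ hj)
  obtain ⟨j, hj, hmin⟩ := Finset.exists_minimal hne
  rw [Set.Finite.mem_toFinset] at hj
  have h1 := G.proj_smul_of_forall_lt j s m fun i hi => by
    by_contra h0
    have := hmin ((Set.Finite.mem_toFinset _).2 h0) hi.le
    omega
  rw [h, map_zero] at h1
  exact hj ((hs.smul_eq_zero).1 h1.symm)

theorem proj_smul_proj (j : ℤ) (s : S) (m : M) :
    G.proj j (s • G.proj j m) = GradedRing.proj 𝒜 0 s • G.proj j m := by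
  rw [proj_smul_of_forall_lt, G.proj_proj, if_pos rfl]
  intro i hi
  rw [G.proj_proj, if_neg hi.ne]

/-- The grading of the kernel of a map of degree zero. -/
noncomputable def ker {F : Type u} [AddCommGroup F] [Module S F] (H : ModuleGrading 𝒜 F)
    (g : F →ₗ[S] M) (hg : ∀ j f, G.proj j (g f) = g (H.proj j f)) :
    ModuleGrading 𝒜 (LinearMap.ker g) where
  proj j := ((H.proj j).comp (LinearMap.ker g).subtype.toAddMonoidHom).codRestrict
    (LinearMap.ker g).toAddSubgroup (fun x => by
      change g (H.proj j x) = 0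
      rw [← hg, x.2, map_zero])
  finite_support m := (H.finite_support m).subset fun j hj h => hj (Subtype.ext h)
  finsum_proj m := by
    apply (LinearMap.ker g).subtype_injective
    change (LinearMap.ker g).subtype.toAddMonoidHom _ = _
    rw [AddMonoidHom.map_finsum _
      ((H.finite_support m).subset fun j hj h => hj (Subtype.ext h))]
    exact H.finsum_proj m
  proj_proj i j m := by
    apply Subtype.ext
    refine (H.proj_proj i j m).trans ?_
    split_ifs <;> rfl
  proj_smul i a ha j m := Subtype.ext (H.proj_smul i a ha j m)

/-- The grading of `S` in which `1` has degree `d`. -/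
noncomputable def shift (d : ℤ) : ModuleGrading 𝒜 S where
  -- The guard is needed because `toNat` would send every degree below `d` to degree 0.
  proj j := if 0 ≤ j - d then (GradedRing.proj 𝒜 (j - d).toNat : S →+ S) else 0
  finite_support m := by
    classical
    refine (((DirectSum.decompose 𝒜 m).support.finite_toSet).image
      fun i : ℕ => (i : ℤ) + d).subset ?_
    intro j hj
    rw [Function.mem_support] at hj
    split_ifs at hj with h
    · refine ⟨(j - d).toNat, ?_, by simp only; omega⟩
      rw [Finset.mem_coe, DFinsupp.mem_support_iff]
      intro h0
      apply hj
      rw [GradedRing.proj_apply, h0]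
      rfl
    · exact absurd rfl hj
  finsum_proj m := by
    classical
    rw [finsum_eq_sum_of_support_subset (s := (DirectSum.decompose 𝒜 m).support.image
      fun i : ℕ => (i : ℤ) + d), Finset.sum_image (fun x _ y _ h => by simpa using h)]
    · conv_rhs => rw [← DirectSum.sum_support_decompose 𝒜 m]
      exact Finset.sum_congr rfl fun i _ => by simp [GradedRing.proj_apply]
    · intro j hj
      rw [Function.mem_support] at hj
      split_ifs at hj with h
      · rw [Finset.coe_image]
        refine ⟨(j - d).toNat, ?_, by simp only; omega⟩
        rw [Finset.mem_coe, DFinsupp.mem_support_iff]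
        intro h0
        apply hj
        rw [GradedRing.proj_apply, h0]
        rfl
      · exact absurd rfl hj
  proj_proj i j m := by
    by_cases hj : 0 ≤ j - d
    · by_cases hi : 0 ≤ i - d
      · rw [if_pos hj, if_pos hi, GradedRing.proj_apply, GradedRing.proj_apply]
        by_cases h : i = j
        · rw [h, DirectSum.decompose_coe, DirectSum.of_eq_same, if_pos rfl]
        · rw [DirectSum.decompose_of_mem_ne 𝒜 (SetLike.coe_mem _) (by omega), if_neg h]
      · rw [if_neg hi, if_neg (fun h : i = j => hi (h ▸ hj))]
        rfl
    · rw [if_neg hj]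
      change _ = if i = j then (0 : S) else 0
      rw [AddMonoidHom.zero_apply, map_zero, ite_self]
  proj_smul i a ha j m := by
    rw [smul_eq_mul, smul_eq_mul]
    by_cases hj : 0 ≤ j - d
    · rw [if_pos hj, if_pos (by omega), GradedRing.proj_apply, GradedRing.proj_apply,
        show (i + j - d).toNat = i + (j - d).toNat by omega]
      exact DirectSum.coe_decompose_mul_add_of_left_mem 𝒜 ha
    · rw [if_neg hj]
      split_ifs with h
      · rw [GradedRing.proj_apply, DirectSum.coe_decompose_mul_of_left_mem_of_not_le 𝒜 ha (by omega)]
        simp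
      · simp

theorem proj_smul_eq_shift {d : ℤ} {y : M} (hy : G.proj d y = y) (j : ℤ) (a : S) :
    G.proj j (a • y) = (shift (𝒜 := 𝒜) d).proj j a • y := by
  classical
  rw [proj_smul_eq_sum, ← hy]
  simp_rw [G.proj_proj]
  simp only [shift]
  split_ifs with h
  · rw [Finset.sum_eq_single (j - d).toNat, if_pos (by omega), GradedRing.proj_apply]
    · intro i _ hi
      rw [if_neg (by omega), smul_zero]
    · intro h0
      rw [DFinsupp.notMem_support_iff.1 h0]
      simp
  · rw [AddMonoidHom.zero_apply, zero_smul]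
    exact Finset.sum_eq_zero fun i _ => by rw [if_neg (by omega), smul_zero]

/-- The grading of a finite product. -/
noncomputable def pi {ι : Type} [Finite ι] {N : ι → Type u} [∀ t, AddCommGroup (N t)]
    [∀ t, Module S (N t)] (G : ∀ t, ModuleGrading 𝒜 (N t)) : ModuleGrading 𝒜 (∀ t, N t) where
  proj j := AddMonoidHom.piMap fun t => (G t).proj j
  finite_support m := by
    refine (Set.finite_iUnion fun t => (G t).finite_support (m t)).subset ?_
    intro j hj
    obtain ⟨t, ht⟩ := Function.ne_iff.1 hj
    exact Set.mem_iUnion.2 ⟨t, ht⟩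
  finsum_proj m := by
    have hfin : (Function.support fun j => AddMonoidHom.piMap (fun t => (G t).proj j) m).Finite := by
      refine (Set.finite_iUnion fun t => (G t).finite_support (m t)).subset ?_
      intro j hj
      obtain ⟨t, ht⟩ := Function.ne_iff.1 hj
      exact Set.mem_iUnion.2 ⟨t, ht⟩
    ext t
    change Pi.evalAddMonoidHom N t _ = m t
    rw [AddMonoidHom.map_finsum _ hfin]
    exact (G t).finsum_proj (m t)
  proj_proj i j m := by
    ext t
    refine ((G t).proj_proj i j (m t)).trans ?_
    split_ifs <;> rfl
  proj_smul i a ha j m := funext fun t => (G t).proj_smul i a ha j (m t)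

/-- The degree zero part of a linear map. -/
noncomputable def degreeZeroPart {F : Type u} [AddCommGroup F] [Module S F] (H : ModuleGrading 𝒜 F)
    (σ : M →ₗ[S] F) : M →ₗ[S] F where
  toFun m := ∑ᶠ j, H.proj j (σ (G.proj j m))
  map_add' x y := by
    simp_rw [map_add]
    refine finsum_add_distrib ((G.finite_support x).subset fun j hj h => hj ?_)
      ((G.finite_support y).subset fun j hj h => hj ?_) <;>
    simp only at h ⊢ <;> rw [h, map_zero, map_zero]
  map_smul' a m := by
    have hfin (y : M) : (Function.support fun j => H.proj j (σ (G.proj j y))).Finite :=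
      (G.finite_support y).subset fun j hj h => hj (by simp only at h ⊢; rw [h, map_zero, map_zero])
    have hadd (x y : M) : ∑ᶠ j, H.proj j (σ (G.proj j (x + y))) =
        ∑ᶠ j, H.proj j (σ (G.proj j x)) + ∑ᶠ j, H.proj j (σ (G.proj j y)) := by
      simp_rw [map_add]
      exact finsum_add_distrib (hfin x) (hfin y)
    rw [RingHom.id_apply]
    induction a using DirectSum.Decomposition.inductionOn 𝒜 with
    | zero => simp
    | @homogeneous i a =>
      rw [smul_finsum' _ (hfin m), ← finsum_comp_equiv (Equiv.addLeft (i : ℤ))]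
      refine finsum_congr fun j => ?_
      rw [Equiv.coe_addLeft, G.proj_smul i a a.2, map_smul, H.proj_smul i a a.2]
    | add a b ha hb => rw [add_smul, hadd, ha, hb, add_smul]

/-- As `g` preserves degrees, the degree-j term becomes the degree-j part of s times the degree-j
part of m, to which only the degree-zero part of `s` contributes. If that part is a unit, a section
up to `s` becomes a genuine one. -/
theorem apply_degreeZeroPart {F : Type u} [AddCommGroup F] [Module S F] (H : ModuleGrading 𝒜 F)
    (σ : M →ₗ[S] F) (g : F →ₗ[S] M) (hg : ∀ j f, G.proj j (g f) = g (H.proj j f)) (s : S)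
    (h : g ∘ₗ σ = s • LinearMap.id) (m : M) :
    g (G.degreeZeroPart H σ m) = GradedRing.proj 𝒜 0 s • m := by
  have hfin : (Function.support fun j => H.proj j (σ (G.proj j m))).Finite :=
    (G.finite_support m).subset fun j hj h => hj (by simp only at h ⊢; rw [h, map_zero, map_zero])
  change g.toAddMonoidHom (∑ᶠ j, H.proj j (σ (G.proj j m))) = _
  conv_rhs => rw [← G.finsum_proj m, smul_finsum' _ (G.finite_support m)]
  rw [AddMonoidHom.map_finsum _ hfin]
  refine finsum_congr fun j => ?_
  rw [LinearMap.toAddMonoidHom_coe, ← hg, ← LinearMap.comp_apply, h, LinearMap.smul_apply,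
    LinearMap.id_apply, proj_smul_proj]

/-- A graded module that is finitely generated is the image of a finite free graded module. -/
theorem exists_free_cover [Module.Finite S M] : ∃ (n : ℕ) (H : ModuleGrading 𝒜 (Fin n → S))
    (g : (Fin n → S) →ₗ[S] M), Function.Surjective g ∧
      ∀ j f, G.proj j (g f) = g (H.proj j f) := by
  classical
  obtain ⟨r, b, hb⟩ := Module.Finite.exists_fin (R := S) (M := M)
  -- Nonzero homogeneous components of the generators, paired with their degrees; the degree is the
  -- shift given to the corresponding copy of `S`.
  let Y : Finset (M × ℤ) := Finset.univ.biUnion fun t =>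
    (G.finite_support (b t)).toFinset.image fun j => (G.proj j (b t), j)
  have hY (y : Y) : G.proj y.1.2 y.1.1 = y.1.1 := by
    obtain ⟨t, -, ht⟩ := Finset.mem_biUnion.1 y.2
    obtain ⟨j, -, hj⟩ := Finset.mem_image.1 ht
    rw [← hj, G.proj_proj, if_pos rfl]
  let y (t : Fin Y.card) : Y := Y.equivFin.symm t
  let g := Fintype.linearCombination S fun t => (y t).1.1
  refine ⟨Y.card, pi fun t => shift (y t).1.2, g, ?_, ?_⟩
  · rw [← LinearMap.range_eq_top, Fintype.range_linearCombination, eq_top_iff, ← hb,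
      Submodule.span_le]
    rintro _ ⟨t, rfl⟩
    rw [← G.finsum_proj (b t), SetLike.mem_coe]
    refine finsum_induction (fun x => x ∈ Submodule.span S (Set.range fun t => (y t).1.1))
      (Submodule.zero_mem _) (fun _ _ => Submodule.add_mem _) fun j => ?_
    by_cases hj : G.proj j (b t) = 0
    · rw [hj]; exact Submodule.zero_mem _
    have hmem : (G.proj j (b t), j) ∈ Y := Finset.mem_biUnion.2 ⟨t, Finset.mem_univ _,
      Finset.mem_image.2 ⟨j, (Set.Finite.mem_toFinset _).2 hj, rfl⟩⟩
    exact Submodule.subset_span ⟨Y.equivFin ⟨_, hmem⟩, by simp [y]⟩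
  · intro j f
    simp only [g, Fintype.linearCombination_apply, map_sum]
    exact Finset.sum_congr rfl fun t _ => G.proj_smul_eq_shift (hY (y t)) j (f t)

/-- This recovers the projective dimension of a graded module from its localization at the
irrelevant ideal. Free covers are chosen graded so that the induction stays among graded modules. -/
theorem hasProjectiveDimensionLT_of_killsExt [IsNoetherianRing S] [Module.Finite S M]
    (G : ModuleGrading 𝒜 M) (n : ℕ) {s : S} (hs : IsUnit (GradedRing.proj 𝒜 0 s))
    (h : KillsExt M n s) : HasProjectiveDimensionLT (ModuleCat.of S M) n := by
  induction n using Nat.twoStepInduction generalizing M with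
  | zero =>
    rw [hasProjectiveDimensionLT_zero_iff_isZero, ModuleCat.isZero_iff_subsingleton]
    rw [killsExt_zero_iff] at h
    exact subsingleton_of_forall_eq 0 fun m => G.smul_eq_zero_of_isUnit hs (h m)
  | one =>
    obtain ⟨r, H, g, hg, hH⟩ := G.exists_free_cover
    rw [← projective_iff_hasProjectiveDimensionLT_one, ← IsProjective.iff_projective]
    obtain ⟨σ, hσ⟩ := exists_section_of_killsExt_one g hg s h
    refine Module.Projective.of_split ((↑hs.unit⁻¹ : S) • G.degreeZeroPart H σ) g ?_
    ext m
    rw [LinearMap.comp_apply, LinearMap.smul_apply, map_smul,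
      G.apply_degreeZeroPart H σ g hH s hσ, smul_smul, IsUnit.val_inv_mul, one_smul,
      LinearMap.id_apply]
  | more n _ ih =>
    obtain ⟨r, H, g, hg, hH⟩ := G.exists_free_cover
    have hS := LinearMap.shortExact_shortComplexKer hg
    have : Projective (ModuleCat.of S (Fin r → S)) :=
      ModuleCat.projective_of_categoryTheory_projective _
    refine (hS.hasProjectiveDimensionLT_X₃_iff n this).2 (ih (G.ker H g hH) ?_)
    exact (killsExt_add_two_iff g hg n s).1 h

end ModuleGrading

end ModuleGradings

/-! ### The graded case: generators of the irrelevant ideal, dimension, and reduction to 𝔪. -/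

section GradedCase

open IsLocalRing

/-- By Nakayama, generating the maximal ideal means spanning the cotangent space, and a spanning set
there contains a basis. -/
theorem IsLocalRing.exists_finset_subset_span_eq_maximalIdeal {R ι : Type*} [CommRing R]
    [IsLocalRing R] [IsNoetherianRing R] (f : ι → R) (X : Finset ι)
    (hX : Ideal.span (f '' X) = maximalIdeal R) :
    ∃ Y ⊆ X, Y.card ≤ (maximalIdeal R).spanFinrank ∧ Ideal.span (f '' Y) = maximalIdeal R := by
  classical
  have key (s : Set (maximalIdeal R)) : Submodule.span (ResidueField R)
      ((maximalIdeal R).toCotangent '' s) = ⊤ ↔ Ideal.span (Subtype.val '' s) = maximalIdeal R := by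
    rw [CotangentSpace.span_image_eq_top_iff,
      ← (Submodule.map_injective_of_injective (maximalIdeal R).injective_subtype).eq_iff,
      Submodule.map_span, Submodule.map_top, Submodule.range_subtype]
    rfl
  have hmem (x) (hx : x ∈ X) : f x ∈ maximalIdeal R := hX ▸ Ideal.subset_span ⟨x, hx, rfl⟩
  let F (x : X) : maximalIdeal R := ⟨f x, hmem x x.2⟩
  have hF (Z : Set X) : Subtype.val '' (F '' Z) = f '' (Subtype.val '' Z) := by
    rw [Set.image_image, Set.image_image]
  have h1 := (key (Set.range F)).2 (by
    rw [← Set.image_univ, hF, Set.image_univ, Subtype.range_coe_subtype]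
    exact hX)
  obtain ⟨t, ht, hcard, hspan, -⟩ := Submodule.exists_finset_span_eq_linearIndepOn
    (ResidueField R) ((maximalIdeal R).toCotangent '' Set.range F)
  rw [h1] at hcard hspan
  rw [← Set.range_comp] at ht
  obtain ⟨Z, hZ⟩ : ∃ Z : Finset X, Z.image ((maximalIdeal R).toCotangent ∘ F) = t ∧
      Z.card ≤ t.card := by
    choose g hg using fun y : t => ht y.2
    refine ⟨Finset.univ.image g, ?_, Finset.card_image_le.trans (by simp)⟩
    ext y
    simp only [Finset.mem_image, Finset.mem_univ, true_and]
    constructor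
    · rintro ⟨_, ⟨z, rfl⟩, rfl⟩
      rw [hg]
      exact z.2
    · exact fun hy => ⟨_, ⟨⟨y, hy⟩, rfl⟩, hg _⟩
  refine ⟨Z.image Subtype.val, ?_, ?_, ?_⟩
  · intro x hx
    obtain ⟨y, -, rfl⟩ := Finset.mem_image.1 hx
    exact y.2
  · rw [spanFinrank_maximalIdeal_eq_finrank_cotangentSpace, ← finrank_top, ← hcard]
    exact Finset.card_image_le.trans hZ.2
  · rw [Finset.coe_image, ← hF, ← key, ← hspan, ← hZ.1, Finset.coe_image, Set.image_comp]

variable {k : Type v} {S : Type u} [Field k] [CommRing S] [Algebra k S] (𝒜 : ℕ → Submodule k S)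
  [GradedAlgebra 𝒜]

theorem HomogeneousIdeal.isUnit_proj_zero_of_notMem_irrelevant
    (h0 : (𝒜 0 : Set S) = Set.range (algebraMap k S)) {s : S}
    (hs : s ∉ (irrelevant 𝒜).toIdeal) : IsUnit (GradedRing.proj 𝒜 0 s) := by
  obtain ⟨c, hc⟩ : GradedRing.proj 𝒜 0 s ∈ Set.range (algebraMap k S) :=
    h0 ▸ SetLike.coe_mem (DirectSum.decompose 𝒜 s 0)
  rw [← hc]
  refine (IsUnit.mk0 c ?_).map _
  rintro rfl
  rw [map_zero] at hc
  exact hs ((mem_irrelevant_iff 𝒜 s).2 hc.symm)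

theorem HomogeneousIdeal.isMaximal_irrelevant [Nontrivial S]
    (h0 : (𝒜 0 : Set S) = Set.range (algebraMap k S)) :
    (irrelevant 𝒜).toIdeal.IsMaximal := by
  refine Ideal.isMaximal_iff.2 ⟨fun h => ?_, fun J s hJ hs hsJ => ?_⟩
  · rw [toIdeal_irrelevant, RingHom.mem_ker, map_one] at h
    exact one_ne_zero h
  · have hu := isUnit_proj_zero_of_notMem_irrelevant 𝒜 h0 hs
    rw [← Ideal.eq_top_iff_one]
    refine Ideal.eq_top_of_isUnit_mem J ?_ hu
    rw [← sub_sub_cancel s (GradedRing.proj 𝒜 0 s)]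
    refine J.sub_mem hsJ (hJ ?_)
    change GradedRing.proj 𝒜 0 _ = 0
    rw [map_sub, sub_eq_zero, GradedRing.proj_apply 𝒜 0 (GradedRing.proj 𝒜 0 s)]
    exact (DirectSum.decompose_of_mem_same 𝒜 (SetLike.coe_mem (DirectSum.decompose 𝒜 s 0))).symm

/-- Induction on the degree: the coefficients of a homogeneous element on the positive-degree
generators can be taken homogeneous of smaller degree. -/
theorem Algebra.adjoin_eq_top_of_span_eq_irrelevant
    (h0 : (𝒜 0 : Set S) = Set.range (algebraMap k S)) (Y : Finset S)
    (hY : ∀ y ∈ Y, ∃ n > 0, y ∈ 𝒜 n)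
    (hspan : Ideal.span Y = (HomogeneousIdeal.irrelevant 𝒜).toIdeal) :
    Algebra.adjoin k (Y : Set S) = ⊤ := by
  classical
  have key (n : ℕ) : ∀ a ∈ 𝒜 n, a ∈ Algebra.adjoin k (Y : Set S) := by
    induction n using Nat.strong_induction_on with
    | _ n ih =>
      intro a ha
      obtain rfl | hn := n.eq_zero_or_pos
      · obtain ⟨c, rfl⟩ : a ∈ Set.range (algebraMap k S) := h0 ▸ ha
        exact Subalgebra.algebraMap_mem _ c
      have h1 : a ∈ Ideal.span (Y : Set S) :=
        hspan ▸ HomogeneousIdeal.mem_irrelevant_of_mem 𝒜 hn ha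
      obtain ⟨c, -, hc⟩ := Submodule.mem_span_finset.1 h1
      rw [← DirectSum.decompose_of_mem_same 𝒜 ha, ← hc, DirectSum.decompose_sum,
        DFinsupp.finsetSum_apply, AddSubmonoidClass.coe_finsetSum]
      refine Subalgebra.sum_mem _ fun y hy => ?_
      obtain ⟨i, hi, hyi⟩ := hY y hy
      rw [smul_eq_mul, DirectSum.coe_decompose_mul_of_right_mem 𝒜 n hyi]
      split_ifs
      · exact Subalgebra.mul_mem _ (ih (n - i) (by omega) _ (SetLike.coe_mem _))
          (Algebra.subset_adjoin hy)
      · exact Subalgebra.zero_mem _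
  refine Algebra.eq_top_iff.2 fun s => ?_
  rw [← DirectSum.sum_support_decompose 𝒜 s]
  exact Subalgebra.sum_mem _ fun i _ => key i _ (SetLike.coe_mem _)

theorem ringKrullDim_le_card_of_adjoin_eq_top (Y : Finset S)
    (h : Algebra.adjoin k (Y : Set S) = ⊤) : ringKrullDim S ≤ Y.card := by
  have hsurj : Function.Surjective (MvPolynomial.aeval (R := k) (Subtype.val : Y → S)) := by
    rw [← AlgHom.range_eq_top, ← Algebra.adjoin_range_eq_range_aeval, ← h]
    simp
  refine (ringKrullDim_le_of_surjective _ hsurj).trans ?_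
  rw [MvPolynomial.ringKrullDim_of_isNoetherianRing, ringKrullDim_eq_zero_of_field]
  simp

/-- Homogeneous generators of 𝔪 are cut down to at most ht 𝔪 many by regularity of S_𝔪. They still
generate 𝔪 globally, hence generate S as a k-algebra. -/
theorem HomogeneousIdeal.ringKrullDim_le_height_irrelevant [Nontrivial S] [IsRegularRing S]
    (h0 : (𝒜 0 : Set S) = Set.range (algebraMap k S)) :
    ringKrullDim S ≤ (irrelevant 𝒜).toIdeal.height := by
  classical
  set 𝔪 := (irrelevant 𝒜).toIdeal with h𝔪
  have : 𝔪.IsMaximal := isMaximal_irrelevant 𝒜 h0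
  let A := Localization.AtPrime 𝔪
  obtain ⟨X, hX, hspan⟩ := (Submodule.fg_span_iff_fg_span_finset_subset
    (⋃ i > 0, (𝒜 i : Set S))).1 (IsNoetherian.noetherian (R := S) _)
  have hspan : 𝔪 = Ideal.span (X : Set S) := (irrelevant_eq_span 𝒜).trans hspan
  have hmap : Ideal.span (algebraMap S A '' X) = maximalIdeal A := by
    rw [← Ideal.map_span, ← hspan]
    exact Localization.AtPrime.map_eq_maximalIdeal
  obtain ⟨Y, hYX, hcard, hY⟩ := IsLocalRing.exists_finset_subset_span_eq_maximalIdeal _ X hmap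
  have hdeg (x) (hx : x ∈ X) : ∃ n > 0, x ∈ 𝒜 n := by
    simpa using hX hx
  have hY' : Ideal.span (Y : Set S) = 𝔪 := by
    refine le_antisymm (hspan ▸ Ideal.span_mono hYX) ?_
    conv_lhs => rw [hspan]
    rw [Ideal.span_le]
    intro x hx
    have h1 : algebraMap S A x ∈ (Ideal.span (Y : Set S)).map (algebraMap S A) := by
      rw [Ideal.map_span, hY, ← hmap]
      exact Ideal.subset_span ⟨x, hx, rfl⟩
    -- Descent from S_𝔪: `s * x` lies in the homogeneous ideal (Y), and its component in the degree
    -- of `x` is a unit times `x`.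
    obtain ⟨s, hs, hsx⟩ := (IsLocalization.algebraMap_mem_map_algebraMap_iff 𝔪.primeCompl A _ x).1 h1
    obtain ⟨n, -, hxn⟩ := hdeg x hx
    have hhom : (Ideal.span (Y : Set S)).IsHomogeneous 𝒜 := by
      refine Ideal.homogeneous_span 𝒜 _ fun y hy => ?_
      obtain ⟨i, -, hi⟩ := hdeg y (hYX hy)
      exact ⟨i, hi⟩
    have h2 := hhom n hsx
    rw [DirectSum.coe_decompose_mul_of_right_mem_of_le 𝒜 hxn le_rfl, Nat.sub_self] at h2
    exact (Ideal.unit_mul_mem_iff_mem _ (isUnit_proj_zero_of_notMem_irrelevant 𝒜 h0 hs)).1 h2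
  refine (ringKrullDim_le_card_of_adjoin_eq_top (k := k) Y
    (Algebra.adjoin_eq_top_of_span_eq_irrelevant 𝒜 h0 Y (fun y hy => hdeg y (hYX hy)) hY')).trans ?_
  rw [← IsLocalization.AtPrime.ringKrullDim_eq_height 𝔪 A,
    ← ((isRegularLocalRing_iff A).1 inferInstance)]
  exact_mod_cast hcard

/-- The upper bound is formal. For the lower one, the formula holds in the localization at 𝔪, and
chains of primes there above P contract to chains in `S`. -/
theorem Ideal.height_add_ringKrullDim_quotient_eq_height {S : Type u} [CommRing S] (𝔪 P : Ideal S)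
    [𝔪.IsPrime] [P.IsPrime] [IsRegularLocalRing (Localization.AtPrime 𝔪)] (hle : P ≤ 𝔪)
    (hdim : ringKrullDim S ≤ 𝔪.height) :
    (P.height : WithBot ℕ∞) + ringKrullDim (S ⧸ P) = 𝔪.height := by
  refine le_antisymm ((Ideal.height_add_ringKrullDim_quotient_le P).trans hdim) ?_
  set A := Localization.AtPrime 𝔪
  have hdisj : Disjoint (𝔪.primeCompl : Set S) P :=
    Set.disjoint_left.2 fun s hs hP => hs (hle hP)
  have hP' : (P.map (algebraMap S A)).IsPrime :=
    IsLocalization.isPrime_of_isPrime_disjoint 𝔪.primeCompl A P inferInstance hdisj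
  obtain ⟨-, -, -, -, h⟩ :=
    IsRegularLocalRing.exists_isWeaklyRegular_height (P.map (algebraMap S A))
  rw [IsLocalization.height_map_of_disjoint 𝔪.primeCompl P hdisj,
    IsLocalization.AtPrime.ringKrullDim_eq_height 𝔪 A] at h
  rw [← h]
  gcongr
  let x : PrimeSpectrum A := ⟨_, hP'⟩
  let f : PrimeSpectrum A → PrimeSpectrum S := PrimeSpectrum.comap (algebraMap S A)
  have hf : StrictMono f := by
    refine Monotone.strictMono_of_injective (fun _ _ hab => Ideal.comap_mono hab) ?_
    exact PrimeSpectrum.localization_comap_injective A 𝔪.primeCompl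
  have hx : f x = ⟨P, inferInstance⟩ := PrimeSpectrum.ext
    (IsLocalization.under_map_of_isPrime_disjoint 𝔪.primeCompl A inferInstance hdisj)
  have h2 := Order.coheight_le_coheight_apply_of_strictMono f hf x
  rw [hx, ← WithBot.coe_le_coe] at h2
  rwa [← ringKrullDim_quotient_eq_coheight, ← ringKrullDim_quotient_eq_coheight] at h2

/-- The grading of a module given by an internal direct sum decomposition. -/
noncomputable def ModuleGrading.ofIsInternal {M : Type u} [AddCommGroup M] [Module S M]
    (ℳ : ℤ → AddSubgroup M) (hℳ : DirectSum.IsInternal ℳ)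
    (h : ∀ (i : ℕ) (j : ℤ), ∀ a ∈ 𝒜 i, ∀ m ∈ ℳ j, a • m ∈ ℳ (i + j)) : ModuleGrading 𝒜 M :=
  let := hℳ.chooseDecomposition
  have hfin (m : M) : (Function.support fun j => (DirectSum.decompose ℳ m j : M)).Finite := by
    classical
    refine (DirectSum.decompose ℳ m).support.finite_toSet.subset fun j hj => ?_
    rw [Finset.mem_coe, DFinsupp.mem_support_iff]
    exact fun h0 => hj (congr_arg Subtype.val h0)
  have hsum (m : M) : ∑ᶠ j, (DirectSum.decompose ℳ m j : M) = m := by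
    classical
    rw [finsum_eq_sum_of_support_subset (s := (DirectSum.decompose ℳ m).support),
      DirectSum.sum_support_decompose]
    intro j hj
    rw [Finset.mem_coe, DFinsupp.mem_support_iff]
    exact fun h0 => hj (congr_arg Subtype.val h0)
  have hproj (i j : ℤ) (m : M) (hm : m ∈ ℳ j) :
      (DirectSum.decompose ℳ m i : M) = if i = j then m else 0 := by
    split_ifs with hij
    · rw [hij, DirectSum.decompose_of_mem_same ℳ hm]
    · exact DirectSum.decompose_of_mem_ne ℳ hm (Ne.symm hij)
  { proj := fun j => AddMonoidHom.mk' (fun m => (DirectSum.decompose ℳ m j : M)) fun x y => by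
      rw [DirectSum.decompose_add]; rfl
    finite_support := hfin
    finsum_proj := hsum
    proj_proj := fun i j m => hproj i j _ (SetLike.coe_mem _)
    proj_smul := fun i a ha j m => by
      classical
      simp only [AddMonoidHom.mk'_apply]
      induction m using DirectSum.Decomposition.inductionOn ℳ with
      | zero => simp
      | @homogeneous l m =>
        rw [hproj j l m m.2, hproj (i + j) (i + l) _ (h i l a ha m m.2)]
        simp
      | add x y hx hy =>
        rw [smul_add, DirectSum.decompose_add, DirectSum.decompose_add, DirectSum.add_apply,
          DirectSum.add_apply, AddSubgroup.coe_add, AddSubgroup.coe_add, hx, hy, smul_add] }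

/-- An element outside 𝔪 acts injectively on M, so no power of it can kill a nonzero element. -/
theorem ModuleGrading.le_irrelevant_of_mem_associatedPrimes {𝒜 : ℕ → Submodule k S}
    [GradedAlgebra 𝒜] (h0 : (𝒜 0 : Set S) = Set.range (algebraMap k S)) {M : Type u}
    [AddCommGroup M] [Module S M] (G : ModuleGrading 𝒜 M) {P : Ideal S}
    (hP : P ∈ associatedPrimes S M) : P ≤ (HomogeneousIdeal.irrelevant 𝒜).toIdeal := by
  obtain ⟨hprime, m, hm⟩ := hP
  intro s hs
  by_contra hs𝔪
  have hunit := HomogeneousIdeal.isUnit_proj_zero_of_notMem_irrelevant 𝒜 h0 hs𝔪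
  rw [hm] at hs
  obtain ⟨n, hn⟩ := hs
  replace hn : s ^ n • m = 0 := by simpa using Submodule.mem_colon_singleton.1 hn
  have hm0 : m = 0 := by
    induction n with
    | zero => simpa using hn
    | succ n ih =>
      rw [pow_succ', mul_smul] at hn
      exact ih (G.smul_eq_zero_of_isUnit hunit hn)
  refine hprime.ne_top (hm.trans ?_)
  rw [hm0, Ideal.radical_eq_top, Ideal.eq_top_iff_one, Submodule.mem_colon_singleton, smul_zero]
  exact Submodule.zero_mem _

theorem tfae_of_isRegularRing_of_moduleGrading [IsDomain S] [IsRegularRing S]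
    {𝒜 : ℕ → Submodule k S} [GradedAlgebra 𝒜]
    (h0 : (𝒜 0 : Set S) = Set.range (algebraMap k S)) {M : Type u}
    [AddCommGroup M] [Module S M] [Module.Finite S M] (G : ModuleGrading 𝒜 M) {e : ℕ}
    (hM : projectiveDimension (ModuleCat.of S M) = e)
    (hTor : Nontrivial (TorMod S e M M) ↔ Nontrivial (ExtSelf S M e →ₗ[S] M)) :
    List.TFAE
      [((depthAt (HomogeneousIdeal.irrelevant 𝒜).toIdeal M : ℕ∞) : WithBot ℕ∞) = omegaInv S M,
        Nontrivial (localCoh (Module.annihilator S (ExtSelf S M e)) 0 M),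
        Nontrivial (ExtSelf S M e →ₗ[S] M),
        Nontrivial (TorMod S e M M)] := by
  set 𝔪 := (HomogeneousIdeal.irrelevant 𝒜).toIdeal with h𝔪
  have hmax : 𝔪.IsMaximal := HomogeneousIdeal.isMaximal_irrelevant 𝒜 h0
  have hdim (P : Ideal S) [P.IsPrime] : ringKrullDim (Localization.AtPrime P) = P.height :=
    IsLocalization.AtPrime.ringKrullDim_eq_height P _
  obtain ⟨d, hd⟩ := exists_ringKrullDim_eq_natCast (Localization.AtPrime 𝔪)
  rw [hdim] at hd
  refine tfae_of_height_add_dim 𝔪 hM (d := d) (by exact_mod_cast hd) (fun P _ n hn => ?_)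
    (fun P hP => ?_) ?_ hTor
  · refine IsRegularLocalRing.projectiveDimension_residueField ?_
    rw [hdim, hn]
    rfl
  · have := hP.isPrime
    exact Ideal.height_add_ringKrullDim_quotient_eq_height 𝔪 P
      (G.le_irrelevant_of_mem_associatedPrimes h0 hP)
      (HomogeneousIdeal.ringKrullDim_le_height_irrelevant 𝒜 h0)
  · refine le_antisymm ?_ ((projectiveDimension_ge_iff _ e).2 fun h => ?_)
    · rw [← hM]
      exact ModuleCat.projectiveDimension_le_projectiveDimension_of_isLocalizedModule 𝔪.primeCompl _
    · obtain ⟨s, hs, hk⟩ := (hasProjectiveDimensionLT_localizedModule_iff 𝔪.primeCompl e M).1 h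
      exact (projectiveDimension_ge_iff (ModuleCat.of S M) e).1 hM.ge
        (G.hasProjectiveDimensionLT_of_killsExt e
          (HomogeneousIdeal.isUnit_proj_zero_of_notMem_irrelevant 𝒜 h0 hs) hk)

end GradedCase
-- The theorem for both kinds of ring.
theorem mainTheorem2 :
    -- `S` a regular local domain
    (∀ (S : Type u) [CommRing S] [IsDomain S] [IsRegularLocalRing S]
        (M : Type u) [AddCommGroup M] [Module S M] [Module.Finite S M] (e : ℕ),
        projectiveDimension (ModuleCat.of S M) = e →
        List.TFAE
          [((depthAt (IsLocalRing.maximalIdeal S) M : ℕ∞) : WithBot ℕ∞) = omegaInv S M,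
            Nontrivial (localCoh (Module.annihilator S (ExtSelf S M e)) 0 M),
            Nontrivial (ExtSelf S M e →ₗ[S] M),
            Nontrivial (TorMod S e M M)]) ∧
    -- `S` a regular, finitely generated, connected graded algebra over a field, and a domain;
    -- `M` a finitely generated graded module
    (∀ (k : Type v) [Field k] (S : Type u) [CommRing S] [IsDomain S] [IsRegularRing S]
        [Algebra k S] [Algebra.FiniteType k S] (𝒜 : ℕ → Submodule k S) [GradedAlgebra 𝒜]
        (_ : (𝒜 0 : Set S) = Set.range (algebraMap k S))
        (M : Type u) [AddCommGroup M] [Module S M] [Module.Finite S M]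
        (ℳ : ℤ → AddSubgroup M) (_ : DirectSum.IsInternal ℳ)
        (_ : ∀ (i : ℕ) (j : ℤ), ∀ a ∈ 𝒜 i, ∀ m ∈ ℳ j, a • m ∈ ℳ (i + j)) (e : ℕ),
        projectiveDimension (ModuleCat.of S M) = e →
        List.TFAE
          [((depthAt (HomogeneousIdeal.irrelevant 𝒜).toIdeal M : ℕ∞) : WithBot ℕ∞) = omegaInv S M,
            Nontrivial (localCoh (Module.annihilator S (ExtSelf S M e)) 0 M),
            Nontrivial (ExtSelf S M e →ₗ[S] M),
            Nontrivial (TorMod S e M M)]) := by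
  refine ⟨?_, ?_⟩
  · intro S _ _ _ M _ _ _ e hM
    have : HasProjectiveDimensionLE (ModuleCat.of S M) e := (projectiveDimension_le_iff _ e).1 hM.le
    exact tfae_of_isRegularLocalRing hM (nontrivial_torMod_iff M M e)
  · intro k _ S _ _ _ _ _ 𝒜 _ h0 M _ _ _ ℳ hℳ hsmul e hM
    have : HasProjectiveDimensionLE (ModuleCat.of S M) e := (projectiveDimension_le_iff _ e).1 hM.le
    exact tfae_of_isRegularRing_of_moduleGrading h0 (.ofIsInternal 𝒜 ℳ hℳ hsmul) hM
      (nontrivial_torMod_iff M M e)
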